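/- Let $n\ge 0$, let $f,g$ be smooth vector fields on $\mathbb R^n$ and $h:\mathbb R^n\to\mathbb R$ a smooth function with $f(0)=0$, $h(0)=0$, and consider the system $\dot x=f(x)+u\,g(x)$, $y=h(x)$. Write $(L_Xp)(x)=\nabla p(x)\cdot X(x)$ and $\mathrm{ad}_XY=[X,Y]$ (Lie bracket of vector fields). Assume that the system has a uniform relative degree $r$, that is, $r\ge 1$, $L_gL_f^kh\equiv 0$ for all $0\le k<r-1$, and $L_gL_f^{r-1}h(x)\neq 0$ for all $x\in\mathbb R^n$. Put $\tilde g=g/(L_gL_f^{r-1}h)$, $\tilde f=f-(L_f^rh)\,\tilde g$ and $\tau_i=\mathrm{ad}_{\tilde f}^{\,i-1}\tilde g$ for $i=1,\dots,r$, and assume that each $\tau_i$ is complete (all its integral curves are defined on all of $\mathbb R$) and that $[\tau_i,\tau_j]=0$ for all $i,j\in\{1,\dots,r\}$. Let $\dot w=Q(w)$, $u=\theta(w)$ be an exosystem, with $Q$ a smooth vector field and $\theta$ a smooth real function on a (finite-dimensional, Hausdorff) smooth manifold $W$, and let $\mathcal U$ be the class of all functions $u(t)=\theta(w(t))$, $t\ge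 0$, where $w$ is a solution of $\dot w=Q(w)$ on $[0,\infty)$. Assume that the exosystem is Poisson-stable: for every $w^0\in W$ the solution with $w(0)=w^0$ is defined for all $t\ge0$, and there are times $t_i\to\infty$ with $w(t_i)\to w^0$. Assume that the system adapts to the inputs in $\mathcal U$: for every $u\in\mathcal U$ and every $x^0\in\mathbb R^n$ the solution of $\dot x=f(x)+u(t)g(x)$, $x(0)=x^0$, exists for all $t\ge 0$ and is bounded, and $h(x(t))\to 0$ as $t\to\infty$. Then the system contains an output-driven internal model of $\mathcal U$. That is, there are an integer $0\le d\le n$, smooth manifolds $Z_1$, $Z_2$ of dimensions $d$ and $n-d$, a smooth function $\kappa:Z_1\to\mathbb R$, smooth maps $f_1,g_1$ assigning to $(z_1,z_2)\in Z_1\times Z_2$ a vector in $T_{z_1}Z_1$, a smooth map $f_2$ assigning to $(y,z_2)\in\mathbb R\times Z_2$ a vector in $T_{z_2}Z_2$, a diffeomorphism $\Phi=(\Phi_1,\Phi_2):\mathbb R^n\to Z_1\times Z_2$, and a smooth function $\varphi:Z_2\to\mathbb R$, such that, in the coordinates $(z_1,z_2)=\Phi(x)$, the system takes the form $$\dot z_1=f_1(z_1,z_2)+u\,g_1(z_1,z_2),\qquad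 \dot z_2=f_2(y,z_2),\qquad y=\kappa(z_1),$$ that is, for all $x\in\mathbb R^n$, $\Phi_*(x)f(x)=\big(f_1(z_1,z_2),f_2(\kappa(z_1),z_2)\big)$, $\Phi_*(x)g(x)=\big(g_1(z_1,z_2),0\big)$ and $\kappa(\Phi_1(x))=h(x)$; and such that for every $u\in\mathcal U$ there is a solution $z_2(\cdot)$ of $\dot z_2=f_2(0,z_2)$ on $[0,\infty)$ with $\varphi(z_2(t))=u(t)$ for all $t\ge 0$. -/

import Mathlib

open Set Filter Topology Manifold
open scoped ContDiff

noncomputable section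

namespace InternalModel

/-- State space `ℝⁿ` (also the local model of an `n`-dimensional manifold). -/
abbrev Vec (n : ℕ) : Type := EuclideanSpace ℝ (Fin n)

/-- A single-input single-output input-affine system `ẋ = f(x) + u g(x)`, `y = h(x)` on `ℝⁿ`,
with smooth data and `f(0) = 0`, `h(0) = 0`. -/
structure AffineSystem (n : ℕ) where
  f : Vec n → Vec n
  g : Vec n → Vec n
  h : Vec n → ℝ
  smooth_f : ContDiff ℝ ∞ f
  smooth_g : ContDiff ℝ ∞ g
  smooth_h : ContDiff ℝ ∞ h
  f_zero : f 0 = 0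
  h_zero : h 0 = 0

/-- Lie derivative `(L_X p)(x) = ∇p(x) · X(x)`. -/
def lieDeriv {n : ℕ} (X : Vec n → Vec n) (p : Vec n → ℝ) : Vec n → ℝ :=
  fun x => fderiv ℝ p x (X x)

/-- A vector field on `ℝⁿ` is complete if every initial value problem has a solution on all
of `ℝ`. -/
def IsCompleteField {n : ℕ} (X : Vec n → Vec n) : Prop :=
  ∀ x₀ : Vec n, ∃ γ : ℝ → Vec n, γ 0 = x₀ ∧ ∀ t : ℝ, HasDerivAt γ (X (γ t)) t

namespace AffineSystem

variable {n : ℕ} (S : AffineSystem n)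

/-- The function `L_f^k h`. -/
def outputDeriv (k : ℕ) : Vec n → ℝ := (lieDeriv S.f)^[k] S.h

/-- The system has uniform relative degree `r`. -/
def HasUniformRelativeDegree (r : ℕ) : Prop :=
  0 < r ∧
  (∀ k : ℕ, k + 1 < r → ∀ x, lieDeriv S.g (S.outputDeriv k) x = 0) ∧
  (∀ x, lieDeriv S.g (S.outputDeriv (r - 1)) x ≠ 0)

/-- `g̃ = g / (L_g L_f^{r-1} h)`. -/
def gTilde (r : ℕ) : Vec n → Vec n :=
  fun x => (lieDeriv S.g (S.outputDeriv (r - 1)) x)⁻¹ • S.g x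

/-- `f̃ = f - (L_f^r h) g̃`. -/
def fTilde (r : ℕ) : Vec n → Vec n :=
  fun x => S.f x - S.outputDeriv r x • S.gTilde r x

/-- `τ_i = ad_{f̃}^{i-1} g̃`, meant for `1 ≤ i ≤ r`, where `ad_X Y = [X, Y]`. -/
def tau (r i : ℕ) : Vec n → Vec n :=
  (fun Y => VectorField.lieBracket ℝ (S.fTilde r) Y)^[i - 1] (S.gTilde r)

/-- `x` solves `ẋ = f(x) + u g(x)` on `[0, ∞)` (one-sided derivative at `0`). -/
def IsForwardSolution (u : ℝ → ℝ) (x : ℝ → Vec n) : Prop :=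
  ∀ t : ℝ, 0 ≤ t → HasDerivWithinAt x (S.f (x t) + u t • S.g (x t)) (Ici 0) t

/-- The system adapts to the inputs in `U`. Inputs are functions on `[0, ∞)`: only their values
at `t ≥ 0` are used. -/
def Adapts (U : Set (ℝ → ℝ)) : Prop :=
  ∀ u ∈ U, ∀ x₀ : Vec n, ∃ x : ℝ → Vec n,
    x 0 = x₀ ∧ S.IsForwardSolution u x ∧
    Bornology.IsBounded (x '' Ici 0) ∧
    Tendsto (fun t => S.h (x t)) atTop (𝓝 0)

/-- There is a change of coordinates `Φ : ℝⁿ → Z₁ × Z₂` bringing the system into the form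
`ż₁ = f₁(z₁, z₂) + u g₁(z₁, z₂)`, `ż₂ = f₂(y, z₂)`, `y = κ(z₁)`, and a function `φ` on `Z₂` such
that every `u ∈ U` is `φ(z₂(t))`, `t ≥ 0`, along some solution of `ż₂ = f₂(0, z₂)`. -/
def HasInternalModelOn (U : Set (ℝ → ℝ)) (d₁ d₂ : ℕ)
    (Z₁ : Type) [TopologicalSpace Z₁] [ChartedSpace (Vec d₁) Z₁]
    [IsManifold (𝓡 d₁) ∞ Z₁]
    (Z₂ : Type) [TopologicalSpace Z₂] [ChartedSpace (Vec d₂) Z₂]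
    [IsManifold (𝓡 d₂) ∞ Z₂] : Prop :=
  ∃ (κ : Z₁ → ℝ)
    (f₁ g₁ : (z₁ : Z₁) → Z₂ → TangentSpace (𝓡 d₁) z₁)
    (f₂ : ℝ → (z₂ : Z₂) → TangentSpace (𝓡 d₂) z₂)
    (Φ : Diffeomorph (𝓡 n) ((𝓡 d₁).prod (𝓡 d₂)) (Vec n) (Z₁ × Z₂) ∞)
    (φ : Z₂ → ℝ),
    -- all data are smooth
    ContMDiff (𝓡 d₁) 𝓘(ℝ, ℝ) ∞ κ ∧
    ContMDiff ((𝓡 d₁).prod (𝓡 d₂)) (𝓡 d₁).tangent ∞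
      (fun p : Z₁ × Z₂ => (⟨p.1, f₁ p.1 p.2⟩ : TangentBundle (𝓡 d₁) Z₁)) ∧
    ContMDiff ((𝓡 d₁).prod (𝓡 d₂)) (𝓡 d₁).tangent ∞
      (fun p : Z₁ × Z₂ => (⟨p.1, g₁ p.1 p.2⟩ : TangentBundle (𝓡 d₁) Z₁)) ∧
    ContMDiff (𝓘(ℝ, ℝ).prod (𝓡 d₂)) (𝓡 d₂).tangent ∞
      (fun p : ℝ × Z₂ => (⟨p.2, f₂ p.1 p.2⟩ : TangentBundle (𝓡 d₂) Z₂)) ∧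
    ContMDiff (𝓡 d₂) 𝓘(ℝ, ℝ) ∞ φ ∧
    -- `Φ_* f` has components `f₁(z₁, z₂)` and `f₂(κ(z₁), z₂)`
    (∀ x : Vec n,
      mfderiv (𝓡 n) (𝓡 d₁) (fun y => (Φ y).1) x (S.f x) = f₁ (Φ x).1 (Φ x).2 ∧
      mfderiv (𝓡 n) (𝓡 d₂) (fun y => (Φ y).2) x (S.f x) = f₂ (κ (Φ x).1) (Φ x).2) ∧
    -- `Φ_* g` has components `g₁(z₁, z₂)` and `0`
    (∀ x : Vec n,
      mfderiv (𝓡 n) (𝓡 d₁) (fun y => (Φ y).1) x (S.g x) = g₁ (Φ x).1 (Φ x).2 ∧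
      mfderiv (𝓡 n) (𝓡 d₂) (fun y => (Φ y).2) x (S.g x) = 0) ∧
    -- the output is `κ(z₁)`
    (∀ x : Vec n, κ (Φ x).1 = S.h x) ∧
    -- the `z₂`-subsystem with `y = 0` generates every input of the class
    (∀ u ∈ U, ∃ z₂ : ℝ → Z₂,
      IsMIntegralCurveOn (I := 𝓡 d₂) z₂ (fun z => f₂ 0 z) (Ici 0) ∧
      ∀ t : ℝ, 0 ≤ t → φ (z₂ t) = u t)

/-- The system contains an output-driven internal model of `U`: for some `d ≤ n` there are smooth
manifolds `Z₁`, `Z₂` of dimensions `d`, `n - d` carrying the required decomposition. -/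
def ContainsOutputDrivenInternalModel (U : Set (ℝ → ℝ)) : Prop :=
  ∃ d : ℕ, d ≤ n ∧
  ∃ (Z₁ : Type) (_ : TopologicalSpace Z₁) (_ : ChartedSpace (Vec d) Z₁)
    (_ : IsManifold (𝓡 d) ∞ Z₁)
    (Z₂ : Type) (_ : TopologicalSpace Z₂) (_ : ChartedSpace (Vec (n - d)) Z₂)
    (_ : IsManifold (𝓡 (n - d)) ∞ Z₂),
    T2Space Z₁ ∧ SecondCountableTopology Z₁ ∧ T2Space Z₂ ∧ SecondCountableTopology Z₂ ∧
    S.HasInternalModelOn U d (n - d) Z₁ Z₂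

end AffineSystem

/-- An exosystem `ẇ = Q(w)`, `u = θ(w)` on an `m`-dimensional manifold `W`, with `Q` a smooth
vector field and `θ` a smooth function. -/
structure Exosystem (m : ℕ) (W : Type*) [TopologicalSpace W] [ChartedSpace (Vec m) W]
    [IsManifold (𝓡 m) ∞ W] where
  Q : (w : W) → TangentSpace (𝓡 m) w
  θ : W → ℝ
  smooth_Q : ContMDiff (𝓡 m) (𝓡 m).tangent ∞
    (fun w => (⟨w, Q w⟩ : TangentBundle (𝓡 m) W))
  smooth_θ : ContMDiff (𝓡 m) 𝓘(ℝ, ℝ) ∞ θ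

namespace Exosystem

variable {m : ℕ} {W : Type*} [TopologicalSpace W] [ChartedSpace (Vec m) W]
  [IsManifold (𝓡 m) ∞ W] (Γ : Exosystem m W)

/-- `w` solves `ẇ = Q(w)` on `[0, ∞)`. -/
def IsForwardSolution (w : ℝ → W) : Prop :=
  IsMIntegralCurveOn (I := 𝓡 m) w Γ.Q (Ici 0)

/-- Poisson stability: the solution from every `w₀` exists on `[0, ∞)` and has `w₀` in its
omega-limit set. -/
def IsPoissonStable : Prop :=
  ∀ w₀ : W, ∃ w : ℝ → W, w 0 = w₀ ∧ Γ.IsForwardSolution w ∧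
    ∃ t : ℕ → ℝ, Tendsto t atTop atTop ∧ Tendsto (fun i => w (t i)) atTop (𝓝 w₀)

/-- The class of inputs generated by the exosystem: all `u(t) = θ(w(t))`, `t ≥ 0`, along the
solutions of `ẇ = Q(w)`. -/
def generatedInputs : Set (ℝ → ℝ) :=
  {u | ∃ w : ℝ → W, Γ.IsForwardSolution w ∧ ∀ t : ℝ, 0 ≤ t → u t = Γ.θ (w t)}

end Exosystem

end InternalModel

end

/-!
The functions `ξ = (h, L_f h, …, L_f^{r-1} h)` have linearly independent differentials: the fields
`X_k = (-1)^{r-1-k} τ_{r-k}`, `0 ≤ k < r`, satisfy `L_{X_k} ξ_i = δ_{ik}`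
(`AffineSystem.lieDeriv_tau`). Since the `X_k` are complete and commute, their flows combine to a
smooth action of `ℝʳ` on `ℝⁿ` under which `ξ` is equivariant with respect to translations. Hence
every orbit meets the submanifold `{ξ = 0}` in exactly one point, and `x ↦ (ξ(x), P(x))`, with `P`
the projection to `{ξ = 0}` along the orbits, is a diffeomorphism `ℝⁿ → ℝʳ × {ξ = 0}`
(`IsTransverseFrame`).

In these coordinates `g`, a multiple of `X_{r-1}`, has no component along `{ξ = 0}`, and the
component of `f` is that of `f̃`. As `[X_k, f̃] = X_{k-1}` for `k ≥ 1`, this component does not change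
along the flows of `X_1, …, X_{r-1}`, so it depends only on `P(x)` and on `ξ_0 = h`
(`IsTransverseFrame.fderiv_frameProj_eq`). This is the required form, with `κ(z₁)` the first
coordinate.

For the internal model property, take `u = θ(w)` and any solution `x` with this input. Along times
`t_i → ∞` with `w(t_i) → w(0)` the bounded sequence `x(t_i)` subconverges, and by continuous
dependence the solution `y` starting from its limit is the limit of the shifts `x(t_i + ·)`. As
`h(x(t)) → 0`, the output along `y` is identically zero (`exists_solution_output_eq_zero`).
Differentiating `h(y(t)) = 0` shows that `y` stays in `{ξ = 0}` and that
`u = -L_f^r h / L_g L_f^{r-1} h` along `y`, so the function `φ` is the restriction of this quotient.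

Three general facts are proved on the way: the flow of a complete smooth vector field is smooth
(`IsFlow.contDiff`), by the implicit function theorem in `C([0, 1], E)`; the zero set of a smooth
submersion is a smooth manifold (`exists_manifold_levelSet`); and forward solutions of smooth vector
fields on manifolds depend continuously on the initial value (`tendsto_forward`).
-/

noncomputable section

namespace InternalModel

/-! ### Superposition operators on spaces of continuous functions -/

section Nemytskii

variable {K : Type} [TopologicalSpace K] [CompactSpace K]
  {E F : Type} [NormedAddCommGroup E] [NormedSpace ℝ E] [NormedAddCommGroup F] [NormedSpace ℝ F]

/-- The pointwise application of a bounded bilinear map to continuous functions on a compact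
space. -/
def pointwiseBilin {G : Type} [NormedAddCommGroup G] [NormedSpace ℝ G] (K : Type)
    [TopologicalSpace K] [CompactSpace K] (B : G →L[ℝ] E →L[ℝ] F) :
    C(K, G) →L[ℝ] C(K, E) →L[ℝ] C(K, F) :=
  LinearMap.mkContinuous₂
    (LinearMap.mk₂ ℝ (fun (A : C(K, G)) (η : C(K, E)) =>
        (⟨fun k => B (A k) (η k), by fun_prop⟩ : C(K, F)))
      (fun _ _ _ => by ext; simp) (fun _ _ _ => by ext; simp)
      (fun _ _ _ => by ext; simp) (fun _ _ _ => by ext; simp)) ‖B‖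
    (fun A η => by
      rw [ContinuousMap.norm_le _ (by positivity)]
      intro k
      exact B.le_of_opNorm₂_le_of_le le_rfl (A.norm_coe_le_norm k) (η.norm_coe_le_norm k))

lemma exists_forall_norm_sub_sub_le {v : E → F} (hv : ContDiff ℝ 1 v) {C : Set E}
    (hC : IsCompact C) {ε : ℝ} (hε : 0 < ε) :
    ∃ δ > 0, ∀ x ∈ C, ∀ y, dist x y < δ → ‖v y - v x - fderiv ℝ v x (y - x)‖ ≤ ε * ‖y - x‖ := by
  have hc : Continuous (fderiv ℝ v) := hv.continuous_fderiv one_ne_zero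
  have hu := hC.uniformContinuousAt_of_continuousAt (fderiv ℝ v) (fun a _ => hc.continuousAt)
    (Metric.dist_mem_uniformity hε)
  obtain ⟨δ, hδ, H⟩ := Metric.mem_uniformity_dist.1 hu
  refine ⟨δ, hδ, fun x hx y hxy => ?_⟩
  have hd : ∀ z, HasFDerivAt v (fderiv ℝ v z) z := fun z =>
    (hv.differentiable one_ne_zero z).hasFDerivAt
  refine (convex_ball x δ).norm_image_sub_le_of_norm_hasFDerivWithin_le'
    (fun z _ => (hd z).hasFDerivWithinAt) (fun z hz => ?_) (Metric.mem_ball_self hδ)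
    (by rwa [Metric.mem_ball, dist_comm])
  have h1 : dist x z < δ := by rwa [dist_comm]
  have h2 : dist (fderiv ℝ v x) (fderiv ℝ v z) < ε := H h1 hx
  rw [← dist_eq_norm, dist_comm]
  exact h2.le

/-- The superposition operator `γ ↦ v ∘ γ` has derivative `η ↦ (Dv ∘ γ) η`. -/
lemma hasFDerivAt_superposition {v : E → F} (hv : ContDiff ℝ 1 v) (γ : C(K, E)) :
    HasFDerivAt (fun γ : C(K, E) => (⟨v ∘ γ, hv.continuous.comp γ.continuous⟩ : C(K, F)))
      (pointwiseBilin K (ContinuousLinearMap.id ℝ (E →L[ℝ] F))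
        ⟨fderiv ℝ v ∘ γ, (hv.continuous_fderiv one_ne_zero).comp γ.continuous⟩) γ := by
  rw [hasFDerivAt_iff_isLittleO, Asymptotics.isLittleO_iff]
  intro ε hε
  obtain ⟨δ, hδ, H⟩ := exists_forall_norm_sub_sub_le hv (isCompact_range γ.continuous) hε
  filter_upwards [Metric.ball_mem_nhds γ hδ] with η hη
  rw [ContinuousMap.norm_le _ (by positivity)]
  intro k
  have h1 : dist (γ k) (η k) < δ :=
    (ContinuousMap.dist_apply_le_dist k).trans_lt (by rwa [dist_comm])
  refine (H (γ k) (mem_range_self k) (η k) h1).trans ?_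
  gcongr
  exact (η - γ).norm_coe_le_norm k

/-- The superposition operator of a `C^m` map is `C^m` on spaces of continuous functions. -/
lemma contDiff_superposition_nat (m : ℕ) : ∀ {F : Type} [NormedAddCommGroup F] [NormedSpace ℝ F]
    {v : E → F} (hv : ContDiff ℝ m v),
    ContDiff ℝ m (fun γ : C(K, E) => (⟨v ∘ γ, hv.continuous.comp γ.continuous⟩ : C(K, F))) := by
  induction m with
  | zero =>
    intro F _ _ v hv
    exact contDiff_zero.2 (ContinuousMap.continuous_postcomp ⟨v, hv.continuous⟩)
  | succ m ih =>
    intro F _ _ v hv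
    have hv1 : ContDiff ℝ 1 v := hv.of_le (by norm_cast; omega)
    have hdv : ContDiff ℝ m (fderiv ℝ v) := hv.fderiv_right (by norm_cast)
    exact contDiff_succ_iff_hasFDerivAt.2
      ⟨_, (pointwiseBilin K (ContinuousLinearMap.id ℝ (E →L[ℝ] F))).contDiff.comp (ih hdv),
        fun γ => hasFDerivAt_superposition hv1 γ⟩

lemma contDiff_superposition {v : E → F} (hv : ContDiff ℝ ∞ v) :
    ContDiff ℝ ∞ (fun γ : C(K, E) => (⟨v ∘ γ, hv.continuous.comp γ.continuous⟩ : C(K, F))) :=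
  contDiff_infty.2 fun m => contDiff_superposition_nat m (hv.of_le (by exact_mod_cast le_top))

end Nemytskii

/-! ### Smooth flows of complete vector fields -/

section Flow

lemma continuous_comp_projIcc {E : Type} [TopologicalSpace E] (η : C(Icc (0 : ℝ) 1, E)) :
    Continuous fun τ => η (projIcc 0 1 zero_le_one τ) :=
  η.continuous.comp continuous_projIcc

variable {E : Type} [NormedAddCommGroup E] [NormedSpace ℝ E]

lemma norm_primitive_le (η : C(Icc (0 : ℝ) 1, E)) (t : Icc (0 : ℝ) 1) :
    ‖∫ τ in (0 : ℝ)..t, η (projIcc 0 1 zero_le_one τ)‖ ≤ ‖η‖ := by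
  refine (intervalIntegral.norm_integral_le_of_norm_le_const
    (fun τ _ => η.norm_coe_le_norm _)).trans ?_
  rw [sub_zero, abs_of_nonneg t.2.1]
  exact mul_le_of_le_one_right (norm_nonneg _) t.2.2

/-- Integration from `0`, as a bounded operator on `C([0, 1], E)`. -/
def primitiveL (E : Type) [NormedAddCommGroup E] [NormedSpace ℝ E] :
    C(Icc (0 : ℝ) 1, E) →L[ℝ] C(Icc (0 : ℝ) 1, E) :=
  LinearMap.mkContinuous
    { toFun := fun η => ⟨fun t => ∫ τ in (0 : ℝ)..t, η (projIcc 0 1 zero_le_one τ),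
        (intervalIntegral.continuous_primitive
          (fun a b => (continuous_comp_projIcc η).intervalIntegrable a b) 0).comp
          continuous_subtype_val⟩
      map_add' := fun η ζ => by
        ext t
        exact intervalIntegral.integral_add ((continuous_comp_projIcc η).intervalIntegrable _ _)
          ((continuous_comp_projIcc ζ).intervalIntegrable _ _)
      map_smul' := fun c η => by
        ext t
        exact intervalIntegral.integral_smul c _ } 1
    (fun η => by
      rw [one_mul, ContinuousMap.norm_le _ (norm_nonneg _)]
      exact fun t => norm_primitive_le η t)

lemma primitiveL_apply (η : C(Icc (0 : ℝ) 1, E)) (t : Icc (0 : ℝ) 1) :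
    primitiveL E η t = ∫ τ in (0 : ℝ)..t, η (projIcc 0 1 zero_le_one τ) := rfl

/-- `φ` is a global flow of the vector field `X`. -/
structure IsFlow (X : E → E) (φ : ℝ → E → E) : Prop where
  zero : ∀ x, φ 0 x = x
  hasDerivAt : ∀ t x, HasDerivAt (fun s => φ s x) (X (φ t x)) t

variable [FiniteDimensional ℝ E]

lemma eqOn_Icc_of_hasDerivAt {X : E → E} (hX : ContDiff ℝ 1 X) {a b : ℝ → E} {T : ℝ}
    (ha : ∀ t ∈ Icc 0 T, HasDerivAt a (X (a t)) t) (hb : ∀ t ∈ Icc 0 T, HasDerivAt b (X (b t)) t)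
    (h0 : a 0 = b 0) : EqOn a b (Icc 0 T) := by
  have hac : ContinuousOn a (Icc 0 T) := fun t ht => (ha t ht).continuousAt.continuousWithinAt
  have hbc : ContinuousOn b (Icc 0 T) := fun t ht => (hb t ht).continuousAt.continuousWithinAt
  have hprop : ProperSpace E := FiniteDimensional.proper ℝ E
  have hcomp : IsCompact (a '' Icc 0 T ∪ b '' Icc 0 T) :=
    (isCompact_Icc.image_of_continuousOn hac).union (isCompact_Icc.image_of_continuousOn hbc)
  obtain ⟨L, hL⟩ := (hX.locallyLipschitz.locallyLipschitzOn
    (s := a '' Icc 0 T ∪ b '' Icc 0 T)).exists_lipschitzOnWith_of_compact hcomp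
  exact ODE_solution_unique_of_mem_Icc_right (v := fun _ => X)
    (s := fun _ => a '' Icc 0 T ∪ b '' Icc 0 T) (fun _ _ => hL) hac
    (fun t ht => (ha t (Ico_subset_Icc_self ht)).hasDerivWithinAt)
    (fun t ht => Or.inl (mem_image_of_mem a (Ico_subset_Icc_self ht))) hbc
    (fun t ht => (hb t (Ico_subset_Icc_self ht)).hasDerivWithinAt)
    (fun t ht => Or.inr (mem_image_of_mem b (Ico_subset_Icc_self ht))) h0

lemma eq_of_hasDerivAt {X : E → E} (hX : ContDiff ℝ 1 X) {a b : ℝ → E}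
    (ha : ∀ t, HasDerivAt a (X (a t)) t) (hb : ∀ t, HasDerivAt b (X (b t)) t)
    (h0 : a 0 = b 0) (t : ℝ) : a t = b t := by
  rcases le_total 0 t with ht | ht
  · exact eqOn_Icc_of_hasDerivAt hX (fun s _ => ha s) (fun s _ => hb s) h0 ⟨ht, le_rfl⟩
  · have key : ∀ {c : ℝ → E}, (∀ t, HasDerivAt c (X (c t)) t) →
        ∀ s, HasDerivAt (fun s => c (-s)) (-X (c (-s))) s := fun hc s => by
      simpa [Function.comp_def] using (hc (-s)).scomp s (hasDerivAt_neg s)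
    have := eqOn_Icc_of_hasDerivAt (X := fun x => -X x) hX.neg (T := -t)
      (fun s _ => key ha s) (fun s _ => key hb s) (by simpa using h0)
      (⟨by linarith, le_rfl⟩ : -t ∈ Icc 0 (-t))
    simpa using this

namespace IsFlow

variable {X : E → E} {φ : ℝ → E → E}

lemma eq_of_curve (hφ : IsFlow X φ) (hX : ContDiff ℝ 1 X) {c : ℝ → E}
    (hc : ∀ t, HasDerivAt c (X (c t)) t) (t : ℝ) : c t = φ t (c 0) :=
  eq_of_hasDerivAt hX hc (fun s => hφ.hasDerivAt s (c 0)) (hφ.zero _).symm t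

lemma add (hφ : IsFlow X φ) (hX : ContDiff ℝ 1 X) (s t : ℝ) (x : E) :
    φ (s + t) x = φ s (φ t x) := by
  have h : ∀ u, HasDerivAt (fun u => φ (u + t) x) (X (φ (u + t) x)) u := fun u =>
    (hφ.hasDerivAt (u + t) x).comp_add_const u t
  simpa using hφ.eq_of_curve hX h s

/-- Near `(0, x₀)` the flow is smooth: `γ(t) = φ(st, x)`, `0 ≤ t ≤ 1`, is the solution of
`γ = x + s ∫ X(γ)` in `C([0, 1], E)`, to which the implicit function theorem applies. -/
lemma contDiffAt_zero (hφ : IsFlow X φ) (hX : ContDiff ℝ ∞ X) (x₀ : E) :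
    ContDiffAt ℝ ∞ (Function.uncurry φ) (0, x₀) := by
  let G : (ℝ × E) × C(Icc (0 : ℝ) 1, E) → C(Icc (0 : ℝ) 1, E) := fun p =>
    p.2 - ContinuousLinearMap.const ℝ (Icc (0 : ℝ) 1) p.1.2 -
      p.1.1 • primitiveL E ⟨X ∘ p.2, hX.continuous.comp p.2.continuous⟩
  have hG : ContDiff ℝ ∞ G := by
    refine (contDiff_snd.sub ((ContinuousLinearMap.contDiff _).comp
      (contDiff_snd.comp contDiff_fst))).sub ((contDiff_fst.comp contDiff_fst).smul ?_)
    exact (primitiveL E).contDiff.comp ((contDiff_superposition hX).comp contDiff_snd)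
  let u : (ℝ × E) × C(Icc (0 : ℝ) 1, E) := ((0, x₀), ContinuousLinearMap.const ℝ _ x₀)
  have hGu : G u = 0 := by simp [G, u]
  have hpart : fderiv ℝ G u ∘L ContinuousLinearMap.inr ℝ (ℝ × E) C(Icc (0 : ℝ) 1, E) =
      ContinuousLinearMap.id ℝ _ := by
    have h1 : HasFDerivAt (fun η : C(Icc (0 : ℝ) 1, E) => ((0, x₀), η))
        (ContinuousLinearMap.inr ℝ (ℝ × E) C(Icc (0 : ℝ) 1, E)) u.2 :=
      hasFDerivAt_prodMk_right _ _
    have h2 : HasFDerivAt G (fderiv ℝ G u) ((0, x₀), u.2) :=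
      (hG.differentiable (by simp) u).hasFDerivAt
    have h3 := h2.comp u.2 h1
    have h4 : HasFDerivAt (G ∘ fun η : C(Icc (0 : ℝ) 1, E) => ((0, x₀), η))
        (ContinuousLinearMap.id ℝ _) u.2 := by
      have : (G ∘ fun η : C(Icc (0 : ℝ) 1, E) => ((0, x₀), η)) =
          fun η => η - ContinuousLinearMap.const ℝ (Icc (0 : ℝ) 1) x₀ := by
        ext η t; simp [G]
      rw [this]
      exact (hasFDerivAt_id _).sub_const _
    exact h3.unique h4
  have hinv : (fderiv ℝ G u ∘L ContinuousLinearMap.inr ℝ (ℝ × E) C(Icc (0 : ℝ) 1, E)).IsInvertible :=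
    ⟨ContinuousLinearEquiv.refl ℝ _, by rw [hpart]; rfl⟩
  have hGat : ContDiffAt ℝ ∞ G u := hG.contDiffAt
  have hne : (∞ : WithTop ℕ∞) ≠ 0 := by simp
  have hsm := hGat.contDiffAt_implicitFunction hne hinv
  have hev := hGat.eventually_apply_implicitFunction hne hinv
  set ψ := hGat.implicitFunction hne hinv with hψ
  have hone : (1 : ℝ) ∈ Icc (0 : ℝ) 1 := ⟨zero_le_one, le_rfl⟩
  have hsm1 : ContDiffAt ℝ ∞ (fun p => ψ p ⟨1, hone⟩) (0, x₀) :=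
    (ContinuousMap.evalCLM ℝ (⟨1, hone⟩ : Icc (0 : ℝ) 1) :
      C(Icc (0 : ℝ) 1, E) →L[ℝ] E).contDiff.contDiffAt.comp _ hsm
  refine hsm1.congr_of_eventuallyEq ?_
  filter_upwards [hev] with p hp
  obtain ⟨s, x⟩ := p
  rw [hGu] at hp
  set γ := ψ (s, x) with hγ
  have hγt : ∀ t : Icc (0 : ℝ) 1, γ t = x + s • ∫ τ in (0 : ℝ)..t,
      X (γ (projIcc 0 1 zero_le_one τ)) := fun t => by
    have h := DFunLike.congr_fun hp t
    simp only [G, ContinuousMap.sub_apply, ContinuousMap.zero_apply, ContinuousMap.smul_apply,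
      primitiveL_apply] at h
    rw [sub_sub, sub_eq_zero] at h
    exact h
  have hcont : Continuous fun τ => X (γ (projIcc 0 1 zero_le_one τ)) :=
    hX.continuous.comp (continuous_comp_projIcc γ)
  let c : ℝ → E := fun t => x + s • ∫ τ in (0 : ℝ)..t, X (γ (projIcc 0 1 zero_le_one τ))
  have hc : ∀ t ∈ Icc (0 : ℝ) 1, HasDerivAt c (s • X (c t)) t := fun t ht => by
    have h1 : c t = γ (projIcc 0 1 zero_le_one t) := by
      rw [projIcc_of_mem _ ht, hγt]
    rw [h1]
    exact ((intervalIntegral.integral_hasDerivAt_right (hcont.intervalIntegrable _ _)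
      (hcont.stronglyMeasurableAtFilter _ _) hcont.continuousAt).const_smul s).const_add x
  have hd : ∀ t ∈ Icc (0 : ℝ) 1, HasDerivAt (fun t => φ (s * t) x) (s • X (φ (s * t) x)) t :=
    fun t _ => by
      have := (hφ.hasDerivAt (s * t) x).scomp t ((hasDerivAt_id t).const_mul s)
      simpa [Function.comp_def] using this
  have := eqOn_Icc_of_hasDerivAt (X := fun x => s • X x)
    ((hX.of_le (by simp)).const_smul s) hd hc (by simp [c, hφ.zero]) hone
  simp only [mul_one] at this
  change φ s x = γ ⟨1, hone⟩
  rw [this, hγt]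

/-- The flow of a complete smooth vector field is jointly smooth in time and initial value. -/
theorem contDiff (hφ : IsFlow X φ) (hX : ContDiff ℝ ∞ X) : ContDiff ℝ ∞ (Function.uncurry φ) := by
  have hX1 : ContDiff ℝ 1 X := hX.of_le (by simp)
  refine contDiff_infty.2 fun m => contDiff_iff_contDiffAt.2 ?_
  rintro ⟨T, x₀⟩
  have hstep : ∀ s t : ℝ, ContDiffAt ℝ m (Function.uncurry φ) (t - s, φ s x₀) →
      ContDiffAt ℝ m (Function.uncurry φ) (s, x₀) →
      ContDiffAt ℝ m (Function.uncurry φ) (t, x₀) := fun s t h1 h2 => by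
    have h3 : ContDiffAt ℝ m (fun p : ℝ × E => φ s p.2) (t, x₀) :=
      h2.comp (t, x₀) (f := fun p : ℝ × E => (s, p.2)) (by fun_prop)
    have h4 : ContDiffAt ℝ m (fun p : ℝ × E => φ (p.1 - s) (φ s p.2)) (t, x₀) :=
      ContDiffAt.comp (t, x₀) (f := fun p : ℝ × E => (p.1 - s, φ s p.2)) h1
        ((contDiffAt_fst.sub contDiffAt_const).prodMk h3)
    refine h4.congr_of_eventuallyEq (Eventually.of_forall fun p => ?_)
    simp only [Function.uncurry]
    rw [← hφ.add hX1, sub_add_cancel]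
  have hsmall : ∀ s, ∀ᶠ p : ℝ × E in 𝓝 (0, φ s x₀), ContDiffAt ℝ m (Function.uncurry φ) p :=
    fun s => ((hφ.contDiffAt_zero hX (φ s x₀)).of_le (by exact_mod_cast le_top)).eventually (by simp)
  have hcont : ∀ s, ContinuousAt (fun s => φ s x₀) s := fun s => (hφ.hasDerivAt s x₀).continuousAt
  -- so the set of times at which the flow is smooth at `x₀` is open and closed in `ℝ`
  refine PreconnectedSpace.induction₂' (fun s t => ContDiffAt ℝ m (Function.uncurry φ) (s, x₀) →
    ContDiffAt ℝ m (Function.uncurry φ) (t, x₀)) (fun s => ?_) ⟨fun _ _ _ h1 h2 h => h2 (h1 h)⟩ 0 T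
    ((hφ.contDiffAt_zero hX x₀).of_le (by exact_mod_cast le_top))
  have h1 : Tendsto (fun t => (t - s, φ s x₀)) (𝓝 s) (𝓝 (0, φ s x₀)) :=
    Continuous.tendsto' (by fun_prop) _ _ (by simp)
  have h2 : Tendsto (fun t => (s - t, φ t x₀)) (𝓝 s) (𝓝 (0, φ s x₀)) :=
    (Continuous.tendsto' (by fun_prop) _ _ (by simp)).prodMk_nhds (hcont s)
  filter_upwards [h1.eventually (hsmall s), h2.eventually (hsmall s)] with t ht1 ht2
  exact ⟨hstep s t ht1, hstep t s ht2⟩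

lemma contDiff_apply (hφ : IsFlow X φ) (hX : ContDiff ℝ ∞ X) (t : ℝ) : ContDiff ℝ ∞ (φ t) :=
  (hφ.contDiff hX).comp (contDiff_prodMk_right t)

/-- The variational equation: the derivative of the flow in the initial value solves the
linearised equation along the trajectory. -/
lemma hasDerivAt_fderiv (hφ : IsFlow X φ) (hX : ContDiff ℝ ∞ X) (t : ℝ) (x w : E) :
    HasDerivAt (fun s => fderiv ℝ (φ s) x w) (fderiv ℝ X (φ t x) (fderiv ℝ (φ t) x w)) t := by
  have hΦ := hφ.contDiff hX
  set Φ := Function.uncurry φ with hΦdef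
  have hd : Differentiable ℝ Φ := hΦ.differentiable (by simp)
  have hd2 : Differentiable ℝ (fderiv ℝ Φ) :=
    (hΦ.fderiv_right (m := ∞) (by simp)).differentiable (by simp)
  have hspace : ∀ s y, fderiv ℝ (φ s) y w = fderiv ℝ Φ (s, y) (0, w) := fun s y => by
    have h : HasFDerivAt (φ s) (fderiv ℝ Φ (s, y) ∘L ContinuousLinearMap.inr ℝ ℝ E) y :=
      (hd (s, y)).hasFDerivAt.comp y (hasFDerivAt_prodMk_right s y)
    rw [h.fderiv]; simp
  have htime : ∀ p : ℝ × E, fderiv ℝ Φ p (1, 0) = X (Φ p) := fun p => by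
    have h : HasDerivAt (fun s => φ s p.2) (fderiv ℝ Φ p (1, 0)) p.1 :=
      HasFDerivAt.comp_hasDerivAt (l := Φ) (f := fun s => (s, p.2)) p.1 (hd p).hasFDerivAt
        ((hasDerivAt_id p.1).prodMk (hasDerivAt_const p.1 p.2))
    exact h.unique (hφ.hasDerivAt p.1 p.2)
  have hsymm : fderiv ℝ (fderiv ℝ Φ) (t, x) (1, 0) (0, w) =
      fderiv ℝ (fderiv ℝ Φ) (t, x) (0, w) (1, 0) :=
    (hΦ.contDiffAt.isSymmSndFDerivAt (by
      rw [minSmoothness_of_isRCLikeNormedField]; exact WithTop.coe_le_coe.2 le_top)) _ _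
  have hmixed : fderiv ℝ (fderiv ℝ Φ) (t, x) (0, w) (1, 0) =
      fderiv ℝ X (φ t x) (fderiv ℝ Φ (t, x) (0, w)) := by
    have h1 : HasFDerivAt (fun p => fderiv ℝ Φ p (1, 0))
        ((fderiv ℝ X (φ t x)) ∘L (fderiv ℝ Φ (t, x))) (t, x) := by
      simp_rw [htime]
      exact ((hX.differentiable (by simp) (Φ (t, x))).hasFDerivAt).comp (t, x)
        (hd (t, x)).hasFDerivAt
    have h2 : HasFDerivAt (fun p => fderiv ℝ Φ p (1, 0)) _ (t, x) :=
      (hd2 (t, x)).hasFDerivAt.clm_apply (hasFDerivAt_const (1, 0) (t, x))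
    have := DFunLike.congr_fun (h1.unique h2) (0, w)
    simpa using this.symm
  simp_rw [hspace]
  rw [← hmixed, ← hsymm]
  have h3 : HasDerivAt (fun s => fderiv ℝ Φ (s, x)) (fderiv ℝ (fderiv ℝ Φ) (t, x) (1, 0)) t :=
    (hd2 (t, x)).hasFDerivAt.comp_hasDerivAt t ((hasDerivAt_id t).prodMk (hasDerivAt_const t x))
  simpa using h3.clm_apply (hasDerivAt_const t ((0, w) : ℝ × E))

/-- If `[X, V] = W` and `[X, W] = 0`, the flow of `X` moves `V` to `V - t W`: both sides of the
identity solve the same inhomogeneous linear equation along the trajectory. -/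
lemma apply_eq_fderiv_add (hφ : IsFlow X φ) (hX : ContDiff ℝ ∞ X) {V W : E → E}
    (hV : ContDiff ℝ ∞ V) (hW : ContDiff ℝ ∞ W)
    (hXV : ∀ x, VectorField.lieBracket ℝ X V x = W x)
    (hXW : ∀ x, VectorField.lieBracket ℝ X W x = 0) (t : ℝ) (x : E) :
    V (φ t x) = fderiv ℝ (φ t) x (V x) + t • W (φ t x) := by
  let d : ℝ → E := fun s => V (φ s x) - fderiv ℝ (φ s) x (V x) - s • W (φ s x)
  have hcomp : ∀ {Y : E → E}, ContDiff ℝ ∞ Y → ∀ s,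
      HasDerivAt (fun s => Y (φ s x)) (fderiv ℝ Y (φ s x) (X (φ s x))) s := fun hY s =>
    (hY.differentiable (by simp) _).hasFDerivAt.comp_hasDerivAt s (hφ.hasDerivAt s x)
  have hd : ∀ s, HasDerivAt d (fderiv ℝ X (φ s x) (d s)) s := fun s => by
    have h : HasDerivAt d _ s := ((hcomp hV s).sub (hφ.hasDerivAt_fderiv hX s x (V x))).sub
      ((hasDerivAt_id s).smul (hcomp hW s))
    refine h.congr_deriv ?_
    have h1 := hXV (φ s x)
    have h2 := hXW (φ s x)
    simp only [VectorField.lieBracket_eq] at h1 h2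
    rw [sub_eq_iff_eq_add] at h1 h2
    simp only [d, map_sub, map_smul, id, h1, h2, one_smul, zero_add]
    abel
  -- compare the integral curves `(φ_s x, d s)` and `(φ_s x, 0)` of the linearised field
  have hTX : ContDiff ℝ 1 (fun p : E × E => (X p.1, fderiv ℝ X p.1 p.2)) := by
    have h1 : ContDiff ℝ ∞ (fderiv ℝ X) := hX.fderiv_right (by simp)
    exact ((hX.comp contDiff_fst).prodMk ((h1.comp contDiff_fst).clm_apply contDiff_snd)).of_le
      (by simp)
  have hd0 : d 0 = 0 := by
    have : φ 0 = id := funext hφ.zero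
    simp [d, this]
  have := eq_of_hasDerivAt hTX (a := fun s => (φ s x, d s)) (b := fun s => (φ s x, 0))
    (fun s => (hφ.hasDerivAt s x).prodMk (hd s))
    (fun s => by simpa using (hφ.hasDerivAt s x).prodMk (hasDerivAt_const s (0 : E)))
    (by simp [hd0]) t
  have h2 : d t = 0 := (Prod.ext_iff.1 this).2
  simp only [d] at h2
  rw [sub_sub, sub_eq_zero] at h2
  exact h2

/-- Flows of commuting vector fields commute. -/
lemma comm (hφ : IsFlow X φ) (hX : ContDiff ℝ ∞ X) {Y : E → E} {ψ : ℝ → E → E}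
    (hψ : IsFlow Y ψ) (hY : ContDiff ℝ ∞ Y) (hXY : ∀ x, VectorField.lieBracket ℝ X Y x = 0)
    (s t : ℝ) (x : E) : φ s (ψ t x) = ψ t (φ s x) := by
  have h : ∀ u, HasDerivAt (fun u => φ s (ψ u x)) (Y (φ s (ψ u x))) u := fun u => by
    have h1 := ((hφ.contDiff_apply hX s).differentiable (by simp) (ψ u x)).hasFDerivAt
      |>.comp_hasDerivAt u (hψ.hasDerivAt u x)
    have h2 := hφ.apply_eq_fderiv_add hX hY (W := fun _ => 0) contDiff_const (by simpa using hXY)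
      (fun y => by simp [VectorField.lieBracket_eq]) s (ψ u x)
    rw [h2]
    simpa [Function.comp_def] using h1
  simpa [hψ.zero] using hψ.eq_of_curve (hY.of_le (by simp)) h t

end IsFlow

end Flow

/-! ### Zero sets of submersions as manifolds -/

section LevelSet

variable {n r : ℕ}

lemma exists_equiv_extending {A : Vec n →L[ℝ] Vec r} (hA : Function.Surjective A) :
    ∃ (p : Vec n →L[ℝ] Vec (n - r)) (T : Vec n ≃L[ℝ] Vec r × Vec (n - r)),
      (T : Vec n →L[ℝ] Vec r × Vec (n - r)) = A.prod p := by
  have hrank := LinearMap.finrank_range_add_finrank_ker (A : Vec n →ₗ[ℝ] Vec r)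
  rw [LinearMap.range_eq_top.2 hA, finrank_top, finrank_euclideanSpace_fin,
    finrank_euclideanSpace_fin] at hrank
  have hker : Module.finrank ℝ (LinearMap.ker (A : Vec n →ₗ[ℝ] Vec r)) =
      Module.finrank ℝ (Vec (n - r)) := by
    rw [finrank_euclideanSpace_fin]; omega
  obtain ⟨P, hP⟩ := (LinearMap.ker (A : Vec n →ₗ[ℝ] Vec r)).subtype.exists_leftInverse_of_injective
    (Submodule.ker_subtype _)
  let p₀ : Vec n →ₗ[ℝ] Vec (n - r) := (LinearEquiv.ofFinrankEq _ _ hker).toLinearMap ∘ₗ P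
  have hinj : Function.Injective ((A : Vec n →ₗ[ℝ] Vec r).prod p₀) := by
    rw [← LinearMap.ker_eq_bot, LinearMap.ker_eq_bot']
    intro v hv
    obtain ⟨h1, h2⟩ := Prod.ext_iff.1 hv
    have h3 : P v = 0 := (LinearEquiv.ofFinrankEq _ _ hker).map_eq_zero_iff.1 h2
    have h4 : P v = ⟨v, h1⟩ := DFunLike.congr_fun hP (⟨v, h1⟩ : LinearMap.ker (A : Vec n →ₗ[ℝ] Vec r))
    rw [h3] at h4
    exact (congrArg Subtype.val h4).symm
  have hfin : Module.finrank ℝ (Vec n) = Module.finrank ℝ (Vec r × Vec (n - r)) := by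
    rw [Module.finrank_prod, finrank_euclideanSpace_fin, finrank_euclideanSpace_fin,
      finrank_euclideanSpace_fin]
    omega
  refine ⟨p₀.toContinuousLinearMap,
    (LinearEquiv.ofInjectiveOfFinrankEq _ hinj hfin).toContinuousLinearEquiv, ?_⟩
  ext v <;> rfl

/-- A submersion `ξ` is the first component of a local diffeomorphism around each point. -/
lemma exists_straightening {ξ : Vec n → Vec r} (hξ : ContDiff ℝ ∞ ξ)
    (hs : ∀ x, Function.Surjective (fderiv ℝ ξ x)) (z : Vec n) :
    ∃ e : OpenPartialHomeomorph (Vec n) (Vec r × Vec (n - r)), z ∈ e.source ∧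
      (∀ x, (e x).1 = ξ x) ∧ ContDiff ℝ ∞ e ∧ ∀ y ∈ e.target, ContDiffAt ℝ ∞ e.symm y := by
  obtain ⟨p, T, hT⟩ := exists_equiv_extending (hs z)
  let G : Vec n → Vec r × Vec (n - r) := fun x => (ξ x, p x)
  have hG : ContDiff ℝ ∞ G := hξ.prodMk p.contDiff
  have hder : ∀ x, HasFDerivAt G ((fderiv ℝ ξ x).prod p) x := fun x =>
    (hξ.differentiable (by simp) x).hasFDerivAt.prodMk p.hasFDerivAt
  let e₀ := hG.contDiffAt.toOpenPartialHomeomorph G (hT ▸ hder z) (by simp : (∞ : WithTop ℕ∞) ≠ 0)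
  let U : Set (Vec n) := fderiv ℝ G ⁻¹' range ((↑) : (Vec n ≃L[ℝ] Vec r × Vec (n - r)) → _)
  have hU : IsOpen U :=
    ContinuousLinearEquiv.isOpen.preimage (hG.continuous_fderiv (by simp))
  have hzU : z ∈ U := ⟨T, by rw [hT, (hder z).fderiv]⟩
  refine ⟨e₀.restrOpen U hU, ⟨hG.contDiffAt.mem_toOpenPartialHomeomorph_source _ _, hzU⟩,
    fun _ => rfl, hG, fun y hy => ?_⟩
  have hmem := (e₀.restrOpen U hU).map_target hy
  obtain ⟨T', hT'⟩ := hmem.2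
  refine OpenPartialHomeomorph.contDiffAt_symm (f₀' := T') _ hy ?_ hG.contDiffAt
  rw [hT']
  exact (hG.differentiable (by simp) _).hasFDerivAt

/-- The chart on `{ξ = 0}` obtained by slicing a local diffeomorphism with first component `ξ`. -/
def sliceChart (ξ : Vec n → Vec r) (e : OpenPartialHomeomorph (Vec n) (Vec r × Vec (n - r)))
    (he : ∀ x, (e x).1 = ξ x) (z : {x // ξ x = 0}) :
    OpenPartialHomeomorph {x // ξ x = 0} (Vec (n - r)) where
  toFun x := (e x).2
  invFun y := open Classical in if h : ξ (e.symm (0, y)) = 0 then ⟨e.symm (0, y), h⟩ else z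
  source := {x | (x : Vec n) ∈ e.source}
  target := {y | ((0 : Vec r), y) ∈ e.target}
  map_source' x hx := by
    have : e x = (0, (e x).2) := Prod.ext ((he x).trans x.2) rfl
    exact this ▸ e.map_source hx
  map_target' y hy := by
    have : ξ (e.symm (0, y)) = 0 := by rw [← he, e.right_inv hy]
    simpa [this] using e.map_target hy
  left_inv' x hx := by
    have h0 : ((0 : Vec r), (e x).2) = e x := Prod.ext ((he x).trans x.2).symm rfl
    apply Subtype.ext
    simp [h0, e.left_inv hx, x.2]
  right_inv' y hy := by
    have : ξ (e.symm (0, y)) = 0 := by rw [← he, e.right_inv hy]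
    simp [this, e.right_inv hy]
  open_source := e.open_source.preimage continuous_subtype_val
  open_target := e.open_target.preimage (by fun_prop)
  continuousOn_toFun := continuous_snd.comp_continuousOn
    (e.continuousOn.comp continuous_subtype_val.continuousOn fun _ hx => hx)
  continuousOn_invFun := by
    have hi : Topology.IsInducing (Subtype.val : {x // ξ x = 0} → Vec n) :=
      Topology.IsInducing.subtypeVal
    refine hi.continuousOn_iff.2 ((e.continuousOn_symm.comp (f := fun y => ((0 : Vec r), y)) (by fun_prop)
      fun _ hy => hy).congr fun y hy => ?_)
    have : ξ (e.symm (0, y)) = 0 := by rw [← he, e.right_inv hy]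
    simp [this]

lemma coe_sliceChart_symm {ξ : Vec n → Vec r}
    {e : OpenPartialHomeomorph (Vec n) (Vec r × Vec (n - r))} (he : ∀ x, (e x).1 = ξ x)
    (z : {x // ξ x = 0}) {y : Vec (n - r)} (hy : ((0 : Vec r), y) ∈ e.target) :
    ((sliceChart ξ e he z).symm y : Vec n) = e.symm (0, y) := by
  have : ξ (e.symm (0, y)) = 0 := by rw [← he, e.right_inv hy]
  exact congrArg Subtype.val (dif_pos this)

/-- The zero set of a smooth submersion `ξ : ℝⁿ → ℝʳ` is a smooth manifold of dimension `n - r`,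
smoothly included in `ℝⁿ`, and maps `ℝⁿ → {ξ = 0}` are smooth when they are smooth into `ℝⁿ`. -/
theorem exists_manifold_levelSet {ξ : Vec n → Vec r} (hξ : ContDiff ℝ ∞ ξ)
    (hs : ∀ x, Function.Surjective (fderiv ℝ ξ x)) :
    ∃ (_ : ChartedSpace (Vec (n - r)) {x // ξ x = 0}) (_ : IsManifold (𝓡 (n - r)) ∞ {x // ξ x = 0}),
      ContMDiff (𝓡 (n - r)) (𝓡 n) ∞ (Subtype.val : {x // ξ x = 0} → Vec n) ∧
      ∀ F : Vec n → {x // ξ x = 0}, ContDiff ℝ ∞ (fun x => (F x : Vec n)) →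
        ContMDiff (𝓡 n) (𝓡 (n - r)) ∞ F := by
  choose e hze he hsm hsymm using fun z : Vec n => exists_straightening hξ hs z
  have hslice : ∀ z : Vec n, ∀ y, ((0 : Vec r), y) ∈ (e z).target →
      ContDiffAt ℝ ∞ (fun y => (e z).symm (0, y)) y := fun z y hy =>
    (hsymm z _ hy).comp y (contDiffAt_const.prodMk contDiffAt_id)
  let cs : ChartedSpace (Vec (n - r)) {x // ξ x = 0} :=
    { atlas := range fun z : {x // ξ x = 0} => sliceChart ξ (e z) (he z) z
      chartAt := fun z => sliceChart ξ (e z) (he z) z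
      mem_chart_source := fun z => hze z
      chart_mem_atlas := fun z => mem_range_self z }
  have hman : IsManifold (𝓡 (n - r)) ∞ {x // ξ x = 0} := by
    refine isManifold_of_contDiffOn _ _ _ ?_
    rintro _ _ ⟨z, rfl⟩ ⟨w, rfl⟩
    simp only [mfld_simps]
    intro y hy
    have hy' : ((0 : Vec r), y) ∈ (e z).target := hy.1
    have h1 : ContDiffAt ℝ ∞ (fun y => (e w ((e z).symm (0, y))).2) y :=
      contDiff_snd.contDiffAt.comp y ((hsm w).contDiffAt.comp y (hslice z y hy'))
    refine (h1.congr_of_eventuallyEq ?_).contDiffWithinAt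
    filter_upwards [((e z).open_target.preimage (by fun_prop :
      Continuous fun y => ((0 : Vec r), y))).mem_nhds hy'] with y' hy''
    change (e w ((sliceChart ξ (e z) (he z) z).symm y' : Vec n)).2 = _
    rw [coe_sliceChart_symm (he z) z hy'']
  refine ⟨cs, hman, fun z => ?_, fun F hF x => ?_⟩
  · rw [contMDiffAt_iff]
    refine ⟨continuous_subtype_val.continuousAt, ?_⟩
    simp only [mfld_simps]
    have hy' : ((0 : Vec r), sliceChart ξ (e z) (he z) z z) ∈ (e z).target :=
      (sliceChart ξ (e z) (he z) z).map_source (hze z)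
    refine ((hslice z _ hy').congr_of_eventuallyEq ?_).contDiffWithinAt
    filter_upwards [((e z).open_target.preimage (by fun_prop :
      Continuous fun y => ((0 : Vec r), y))).mem_nhds hy'] with y' hy''
    exact coe_sliceChart_symm (he z) z hy''
  · rw [contMDiffAt_iff_target]
    refine ⟨(continuous_induced_rng.2 hF.continuous).continuousAt, ?_⟩
    have h1 : ContDiff ℝ ∞ fun x' => (e (F x) (F x')).2 :=
      contDiff_snd.comp ((hsm (F x)).comp hF)
    exact h1.contMDiff.contMDiffAt

end LevelSet

/-! ### Commuting frames transverse to the fibres of a map -/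

section Frame

variable {n r : ℕ}

/-- The vector fields `X k`, with global flows `φ k`, are smooth, commute with each other, and are
mapped by the smooth map `ξ : ℝⁿ → ℝʳ` to the coordinate fields of `ℝʳ`. -/
structure IsTransverseFrame (ξ : Vec n → Vec r) (X : Fin r → Vec n → Vec n)
    (φ : Fin r → ℝ → Vec n → Vec n) : Prop where
  contDiff_map : ContDiff ℝ ∞ ξ
  contDiff : ∀ k, ContDiff ℝ ∞ (X k)
  isFlow : ∀ k, IsFlow (X k) (φ k)
  lieBracket_eq_zero : ∀ j k x, VectorField.lieBracket ℝ (X j) (X k) x = 0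
  fderiv_apply : ∀ k x, fderiv ℝ ξ x (X k x) = EuclideanSpace.single k 1

/-- The composition of the flows `φ k` at the times `s k`, for `k` running through a list. -/
def composeFlows (φ : Fin r → ℝ → Vec n → Vec n) (l : List (Fin r)) (s : Vec r) (x : Vec n) :
    Vec n :=
  l.foldr (fun k y => φ k (s k) y) x

/-- The action of `s ∈ ℝʳ` on `ℝⁿ`: each flow `φ k` is run for the time `s k`. -/
def frameAction (φ : Fin r → ℝ → Vec n → Vec n) (s : Vec r) (x : Vec n) : Vec n :=
  composeFlows φ (List.finRange r) s x

/-- The projection of `ℝⁿ` to `{ξ = 0}` along the orbits of the action. -/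
def frameProj (ξ : Vec n → Vec r) (φ : Fin r → ℝ → Vec n → Vec n) (x : Vec n) : Vec n :=
  frameAction φ (-ξ x) x

namespace IsTransverseFrame

variable {ξ : Vec n → Vec r} {X : Fin r → Vec n → Vec n} {φ : Fin r → ℝ → Vec n → Vec n}

lemma flow_comm (h : IsTransverseFrame ξ X φ) (j k : Fin r) (s t : ℝ) (x : Vec n) :
    φ j s (φ k t x) = φ k t (φ j s x) :=
  (h.isFlow j).comm (h.contDiff j) (h.isFlow k) (h.contDiff k) (h.lieBracket_eq_zero j k) s t x

lemma flow_composeFlows (h : IsTransverseFrame ξ X φ) (k : Fin r) (t : ℝ) (l : List (Fin r))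
    (s : Vec r) (x : Vec n) :
    φ k t (composeFlows φ l s x) = composeFlows φ l s (φ k t x) := by
  induction l with
  | nil => rfl
  | cons j l ih =>
    change φ k t (φ j (s j) (composeFlows φ l s x)) = φ j (s j) (composeFlows φ l s (φ k t x))
    rw [h.flow_comm, ih]

lemma composeFlows_add (h : IsTransverseFrame ξ X φ) (l : List (Fin r)) (s t : Vec r)
    (x : Vec n) :
    composeFlows φ l (s + t) x = composeFlows φ l s (composeFlows φ l t x) := by
  induction l with
  | nil => rfl
  | cons k l ih =>
    change φ k (s k + t k) (composeFlows φ l (s + t) x) =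
      φ k (s k) (composeFlows φ l s (φ k (t k) (composeFlows φ l t x)))
    rw [(h.isFlow k).add ((h.contDiff k).of_le (by simp)), ih, h.flow_composeFlows]

lemma frameAction_add (h : IsTransverseFrame ξ X φ) (s t : Vec r) (x : Vec n) :
    frameAction φ (s + t) x = frameAction φ s (frameAction φ t x) :=
  h.composeFlows_add _ s t x

lemma composeFlows_of_forall_eq_zero (h : IsTransverseFrame ξ X φ) {l : List (Fin r)} {s : Vec r}
    (hs : ∀ k ∈ l, s k = 0) (x : Vec n) : composeFlows φ l s x = x := by
  induction l with
  | nil => rfl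
  | cons k l ih =>
    change φ k (s k) (composeFlows φ l s x) = x
    rw [hs k (by simp), (h.isFlow k).zero, ih fun j hj => hs j (by simp [hj])]

lemma frameAction_zero (h : IsTransverseFrame ξ X φ) (x : Vec n) : frameAction φ 0 x = x :=
  h.composeFlows_of_forall_eq_zero (fun _ _ => rfl) x

lemma composeFlows_single (h : IsTransverseFrame ξ X φ) {l : List (Fin r)} (hl : l.Nodup)
    {k : Fin r} (hk : k ∈ l) (t : ℝ) (x : Vec n) :
    composeFlows φ l (EuclideanSpace.single k t) x = φ k t x := by
  induction l with
  | nil => simp at hk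
  | cons j l ih =>
    change φ j (EuclideanSpace.single k t j) (composeFlows φ l (EuclideanSpace.single k t) x) = _
    rw [List.nodup_cons] at hl
    by_cases hjk : j = k
    · subst hjk
      rw [h.composeFlows_of_forall_eq_zero, PiLp.single_apply, if_pos rfl]
      intro i hi
      have : i ≠ j := fun hij => hl.1 (hij ▸ hi)
      simp [this]
    · rw [ih hl.2 ((List.mem_cons.1 hk).resolve_left (Ne.symm hjk)), PiLp.single_apply,
        if_neg hjk, (h.isFlow j).zero]

lemma frameAction_single (h : IsTransverseFrame ξ X φ) (k : Fin r) (t : ℝ) (x : Vec n) :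
    frameAction φ (EuclideanSpace.single k t) x = φ k t x :=
  h.composeFlows_single (List.nodup_finRange r) (List.mem_finRange k) t x

lemma map_flow (h : IsTransverseFrame ξ X φ) (k : Fin r) (t : ℝ) (x : Vec n) :
    ξ (φ k t x) = ξ x + EuclideanSpace.single k t := by
  have hs : ∀ t : ℝ, EuclideanSpace.single k t = t • (EuclideanSpace.single k 1 : Vec r) :=
    fun t => by ext i; simp
  have hd : ∀ t, HasDerivAt (fun t => ξ (φ k t x) - t • (EuclideanSpace.single k 1 : Vec r)) 0 t :=
    fun t => by
    have h1 := ((h.contDiff_map.differentiable (by simp) (φ k t x)).hasFDerivAt.comp_hasDerivAt t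
      ((h.isFlow k).hasDerivAt t x)).sub
        ((hasDerivAt_id t).smul_const (EuclideanSpace.single k 1 : Vec r))
    rw [h.fderiv_apply, one_smul, sub_self] at h1
    exact h1
  have := is_const_of_deriv_eq_zero (fun t => (hd t).differentiableAt) (fun t => (hd t).deriv) t 0
  simp only [(h.isFlow k).zero, zero_smul, sub_zero] at this
  rw [hs, ← this, sub_add_cancel]

lemma map_composeFlows_apply (h : IsTransverseFrame ξ X φ) {l : List (Fin r)} (hl : l.Nodup)
    (s : Vec r) (x : Vec n) (i : Fin r) :
    ξ (composeFlows φ l s x) i = ξ x i + if i ∈ l then s i else 0 := by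
  induction l with
  | nil => simp [composeFlows]
  | cons k l ih =>
    rw [List.nodup_cons] at hl
    change ξ (φ k (s k) (composeFlows φ l s x)) i = _
    rw [h.map_flow, PiLp.add_apply, ih hl.2, PiLp.single_apply]
    by_cases hik : i = k
    · subst hik; simp [hl.1]
    · simp [hik]

lemma map_frameAction (h : IsTransverseFrame ξ X φ) (s : Vec r) (x : Vec n) :
    ξ (frameAction φ s x) = ξ x + s := by
  ext i
  simp [frameAction, h.map_composeFlows_apply (List.nodup_finRange r)]

lemma contDiff_composeFlows (h : IsTransverseFrame ξ X φ) (l : List (Fin r)) :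
    ContDiff ℝ ∞ (fun p : Vec r × Vec n => composeFlows φ l p.1 p.2) := by
  induction l with
  | nil => exact contDiff_snd
  | cons k l ih =>
    have hk : ContDiff ℝ ∞ (fun p : Vec r × Vec n => p.1 k) := by fun_prop
    exact ((h.isFlow k).contDiff (h.contDiff k)).comp (hk.prodMk ih)

lemma contDiff_frameAction (h : IsTransverseFrame ξ X φ) :
    ContDiff ℝ ∞ (fun p : Vec r × Vec n => frameAction φ p.1 p.2) :=
  h.contDiff_composeFlows _

lemma contDiff_frameProj (h : IsTransverseFrame ξ X φ) : ContDiff ℝ ∞ (frameProj ξ φ) :=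
  h.contDiff_frameAction.comp (h.contDiff_map.neg.prodMk contDiff_id)

lemma map_frameProj (h : IsTransverseFrame ξ X φ) (x : Vec n) : ξ (frameProj ξ φ x) = 0 := by
  rw [frameProj, h.map_frameAction, add_neg_cancel]

lemma frameProj_of_map_eq_zero (h : IsTransverseFrame ξ X φ) {x : Vec n} (hx : ξ x = 0) :
    frameProj ξ φ x = x := by
  rw [frameProj, hx, neg_zero, h.frameAction_zero]

lemma frameAction_frameProj (h : IsTransverseFrame ξ X φ) (x : Vec n) :
    frameAction φ (ξ x) (frameProj ξ φ x) = x := by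
  rw [frameProj, ← h.frameAction_add, add_neg_cancel, h.frameAction_zero]

lemma frameProj_frameAction (h : IsTransverseFrame ξ X φ) (s : Vec r) (x : Vec n) :
    frameProj ξ φ (frameAction φ s x) = frameProj ξ φ x := by
  rw [frameProj, h.map_frameAction, ← h.frameAction_add, frameProj]
  congr 1
  abel

lemma frameProj_flow (h : IsTransverseFrame ξ X φ) (k : Fin r) (t : ℝ) (x : Vec n) :
    frameProj ξ φ (φ k t x) = frameProj ξ φ x := by
  rw [← h.frameAction_single, h.frameProj_frameAction]

lemma fderiv_frameProj_apply (h : IsTransverseFrame ξ X φ) (k : Fin r) (x : Vec n) :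
    fderiv ℝ (frameProj ξ φ) x (X k x) = 0 := by
  have h1 : HasDerivAt (fun t => frameProj ξ φ (φ k t x))
      (fderiv ℝ (frameProj ξ φ) (φ k 0 x) (X k (φ k 0 x))) 0 :=
    HasFDerivAt.comp_hasDerivAt (l := frameProj ξ φ) (f := fun t => φ k t x) (0 : ℝ)
      (h.contDiff_frameProj.differentiable (by simp) (φ k 0 x)).hasFDerivAt
      ((h.isFlow k).hasDerivAt 0 x)
  simp only [h.frameProj_flow, (h.isFlow k).zero] at h1
  exact h1.unique (hasDerivAt_const 0 _)

lemma surjective_fderiv (h : IsTransverseFrame ξ X φ) (x : Vec n) :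
    Function.Surjective (fderiv ℝ ξ x) := fun s => by
  refine ⟨∑ k, s k • X k x, ?_⟩
  simp only [map_sum, map_smul, h.fderiv_apply]
  ext i
  simp [Pi.single_apply]

/-- If `[X k, V]` is tangent to the orbits, the projection of `V` is constant along the flow
of `X k`. -/
lemma fderiv_frameProj_flow (h : IsTransverseFrame ξ X φ) {V : Vec n → Vec n}
    (hV : ContDiff ℝ ∞ V) {j k : Fin r} (hVk : ∀ x, VectorField.lieBracket ℝ (X k) V x = X j x)
    (t : ℝ) (x : Vec n) :
    fderiv ℝ (frameProj ξ φ) (φ k t x) (V (φ k t x)) = fderiv ℝ (frameProj ξ φ) x (V x) := by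
  have h1 : HasFDerivAt (fun y => frameProj ξ φ (φ k t y)) _ x :=
    (h.contDiff_frameProj.differentiable (by simp) (φ k t x)).hasFDerivAt.comp x
      (((h.isFlow k).contDiff_apply (h.contDiff k) t).differentiable (by simp) x).hasFDerivAt
  simp only [h.frameProj_flow] at h1
  rw [(h.isFlow k).apply_eq_fderiv_add (h.contDiff k) hV (h.contDiff j) hVk
    (h.lieBracket_eq_zero k j) t x, map_add, map_smul, h.fderiv_frameProj_apply, smul_zero,
    add_zero, ← ContinuousLinearMap.comp_apply, ← h1.fderiv]

lemma fderiv_frameProj_composeFlows (h : IsTransverseFrame ξ X φ) {V : Vec n → Vec n}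
    (hV : ContDiff ℝ ∞ V) {i : Fin r}
    (hVX : ∀ k ≠ i, ∃ j, ∀ x, VectorField.lieBracket ℝ (X k) V x = X j x)
    {s : Vec r} (hs : s i = 0) (l : List (Fin r)) (x : Vec n) :
    fderiv ℝ (frameProj ξ φ) (composeFlows φ l s x) (V (composeFlows φ l s x)) =
      fderiv ℝ (frameProj ξ φ) x (V x) := by
  induction l with
  | nil => rfl
  | cons k l ih =>
    rw [← ih]
    change fderiv ℝ (frameProj ξ φ) (φ k (s k) (composeFlows φ l s x))
      (V (φ k (s k) (composeFlows φ l s x))) = _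
    by_cases hk : k = i
    · rw [hk, hs, (h.isFlow i).zero]
    · obtain ⟨j, hj⟩ := hVX k hk
      exact h.fderiv_frameProj_flow hV hj _ _

/-- If the fields `[X k, V]`, `k ≠ i`, are tangent to the orbits, the projection of `V` to
`{ξ = 0}` depends on `x` only through `ξ x i` and the projection of `x`. -/
theorem fderiv_frameProj_eq (h : IsTransverseFrame ξ X φ) {V : Vec n → Vec n}
    (hV : ContDiff ℝ ∞ V) {i : Fin r}
    (hVX : ∀ k ≠ i, ∃ j, ∀ x, VectorField.lieBracket ℝ (X k) V x = X j x) (x : Vec n) :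
    fderiv ℝ (frameProj ξ φ) x (V x) =
      fderiv ℝ (frameProj ξ φ) (φ i (ξ x i) (frameProj ξ φ x))
        (V (φ i (ξ x i) (frameProj ξ φ x))) := by
  have hs : (ξ x - EuclideanSpace.single i (ξ x i)) i = 0 := by simp
  have hx : frameAction φ (ξ x - EuclideanSpace.single i (ξ x i))
      (φ i (ξ x i) (frameProj ξ φ x)) = x := by
    rw [← h.frameAction_single, ← h.frameAction_add, sub_add_cancel, h.frameAction_frameProj]
  have := h.fderiv_frameProj_composeFlows hV hVX hs (List.finRange r)
    (φ i (ξ x i) (frameProj ξ φ x))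
  change fderiv ℝ (frameProj ξ φ) (frameAction φ _ _) (V (frameAction φ _ _)) = _ at this
  rwa [hx] at this

end IsTransverseFrame

end Frame

/-! ### Continuous dependence on manifolds -/

section ManifoldFlow

variable {m : ℕ} {W : Type*} [TopologicalSpace W] [ChartedSpace (Vec m) W]
  [IsManifold (𝓡 m) ∞ W]

/-- A smooth vector field on a manifold has a local flow, continuous in time and initial value. -/
lemma exists_localFlow {Q : (w : W) → TangentSpace (𝓡 m) w}
    (hQ : ContMDiff (𝓡 m) (𝓡 m).tangent ∞ (fun w => (⟨w, Q w⟩ : TangentBundle (𝓡 m) W))) (p : W) :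
    ∃ (F : W → ℝ → W) (V : Set W) (ε : ℝ), IsOpen V ∧ p ∈ V ∧ 0 < ε ∧
      (∀ q ∈ V, F q 0 = q ∧ IsMIntegralCurveOn (I := 𝓡 m) (F q) Q (Ioo (-ε) ε)) ∧
      ∀ q ∈ V, ∀ t ∈ Ioo (-ε) ε, ContinuousAt (Function.uncurry F) (q, t) := by
  have hv := hQ.contMDiffAt (x := p)
  rw [contMDiffAt_iff] at hv
  obtain ⟨_, hv⟩ := hv
  have hv1 := (hv.contDiffAt (range_mem_nhds_isInteriorPoint
    BoundarylessManifold.isInteriorPoint)).snd.of_le (m := 1) (by simp)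
  obtain ⟨ε, hε, a, ρ, L, K, hρ, hPL⟩ := IsPicardLindelof.of_contDiffAt_one hv1
  obtain ⟨α, hα, hαc⟩ :=
    (hPL 0).exists_forall_mem_closedBall_eq_hasDerivWithinAt_continuousOn
  set y₀ := extChartAt (𝓡 m) p p with hy₀
  have htarget : IsOpen (extChartAt (𝓡 m) p).target := isOpen_extChartAt_target p
  have hy₀t : y₀ ∈ (extChartAt (𝓡 m) p).target := mem_extChartAt_target p
  have hα0 : α (y₀, 0) = y₀ := (hα y₀ (Metric.mem_closedBall_self ρ.2)).1
  have hnhds : Metric.closedBall y₀ ρ ×ˢ Icc (0 - ε) (0 + ε) ∈ 𝓝 (y₀, (0 : ℝ)) :=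
    prod_mem_nhds (Metric.closedBall_mem_nhds _ hρ) (Icc_mem_nhds (by linarith) (by linarith))
  have hev : ∀ᶠ z in 𝓝 (y₀, (0 : ℝ)), z ∈ interior (Metric.closedBall y₀ ρ ×ˢ Icc (0 - ε) (0 + ε)) ∧
      α z ∈ (extChartAt (𝓡 m) p).target :=
    (isOpen_interior.eventually_mem (mem_interior_iff_mem_nhds.2 hnhds)).and
      ((hαc.continuousAt hnhds).eventually (htarget.eventually_mem (by rwa [hα0])))
  obtain ⟨δ, hδ, hsub⟩ := Metric.eventually_nhds_iff_ball.1 hev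
  have hgood : ∀ y ∈ Metric.ball y₀ δ, ∀ t ∈ Ioo (-δ) δ, (y ∈ Metric.closedBall y₀ ρ ∧
      Icc (0 - ε) (0 + ε) ∈ 𝓝 t) ∧ ContinuousAt α (y, t) ∧
      α (y, t) ∈ (extChartAt (𝓡 m) p).target := fun y hy t ht => by
    have hmem : (y, t) ∈ Metric.ball (y₀, (0 : ℝ)) δ := by
      rw [← ball_prod_same]
      exact ⟨hy, by rwa [Real.ball_eq_Ioo, zero_sub, zero_add]⟩
    obtain ⟨h1, h2⟩ := hsub _ hmem
    have h3 := mem_interior_iff_mem_nhds.1 h1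
    have h4 : Icc (0 - ε) (0 + ε) ∈ 𝓝 t := by
      rw [interior_prod_eq] at h1
      exact mem_interior_iff_mem_nhds.1 h1.2
    exact ⟨⟨(interior_subset h1).1, h4⟩, hαc.continuousAt h3, h2⟩
  refine ⟨fun q t => (extChartAt (𝓡 m) p).symm (α (extChartAt (𝓡 m) p q, t)),
    (extChartAt (𝓡 m) p).source ∩ extChartAt (𝓡 m) p ⁻¹' Metric.ball y₀ δ, δ,
    isOpen_extChartAt_preimage' p Metric.isOpen_ball,
    ⟨mem_extChartAt_source p, Metric.mem_ball_self hδ⟩, hδ, fun q hq => ⟨?_, ?_⟩,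
    fun q hq t ht => ?_⟩
  · obtain ⟨⟨h1, -⟩, -⟩ := hgood _ hq.2 0 ⟨by linarith, hδ⟩
    change (extChartAt (𝓡 m) p).symm (α (extChartAt (𝓡 m) p q, 0)) = q
    rw [(hα _ h1).1, (extChartAt (𝓡 m) p).left_inv hq.1]
  · intro t ht
    obtain ⟨⟨h1, h2⟩, -, h3⟩ := hgood _ hq.2 t ht
    set c : ℝ → Vec m := fun t => α (extChartAt (𝓡 m) p q, t) with hc
    have hd := ((hα _ h1).2 t (mem_of_mem_nhds h2)).hasDerivAt h2
    let w : W := (extChartAt (𝓡 m) p).symm (c t)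
    have h : HasDerivAt c (fderivWithin ℝ (extChartAt (𝓡 m) p ∘ (extChartAt (𝓡 m) w).symm)
      (range (𝓡 m)) (extChartAt (𝓡 m) w w) (Q w)) t := hd
    let v : Vec m := Q w
    change HasDerivAt c (fderivWithin ℝ (extChartAt (𝓡 m) p ∘ (extChartAt (𝓡 m) w).symm)
      (range (𝓡 m)) (extChartAt (𝓡 m) w w) v) t at h
    rw [← tangentCoordChange_def] at h
    have hw1 : w ∈ (extChartAt (𝓡 m) p).source := (extChartAt (𝓡 m) p).map_target h3
    have hw2 : w ∈ (extChartAt (𝓡 m) w).source := mem_extChartAt_source w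
    have h4 := hasFDerivWithinAt_tangentCoordChange (I := 𝓡 m) (x := p) (y := w) ⟨hw1, hw2⟩
    rw [(extChartAt (𝓡 m) p).right_inv h3] at h4
    have h5 : HasDerivAt ((extChartAt (𝓡 m) w ∘ (extChartAt (𝓡 m) p).symm) ∘ c) v t := by
      have := (h4.hasFDerivAt (by simp)).comp_hasDerivAt t h
      rwa [tangentCoordChange_comp ⟨⟨hw2, hw1⟩, hw2⟩, tangentCoordChange_self hw2] at this
    apply HasMFDerivAt.hasMFDerivWithinAt
    refine ⟨ContinuousAt.comp (g := (extChartAt (𝓡 m) p).symm) (f := c)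
      (continuousAt_extChartAt_symm'' h3) h.continuousAt, ?_⟩
    exact h5.hasFDerivAt.hasFDerivWithinAt
  · obtain ⟨-, h1, h2⟩ := hgood _ hq.2 t ht
    have hchart : ContinuousAt (fun z : W × ℝ => (extChartAt (𝓡 m) p z.1, z.2)) (q, t) :=
      ((continuousAt_extChartAt' hq.1).comp continuousAt_fst).prodMk continuousAt_snd
    exact ContinuousAt.comp (g := (extChartAt (𝓡 m) p).symm)
      (continuousAt_extChartAt_symm'' h2) (ContinuousAt.comp (g := α) h1 hchart)

/-- A forward solution extends to an integral curve on an open interval containing `[0, ∞)`. -/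
lemma exists_extension_of_forward {Q : (w : W) → TangentSpace (𝓡 m) w}
    (hQ : ContMDiff (𝓡 m) (𝓡 m).tangent ∞ (fun w => (⟨w, Q w⟩ : TangentBundle (𝓡 m) W)))
    {b : ℝ → W} (hb : IsMIntegralCurveOn (I := 𝓡 m) b Q (Ici 0)) :
    ∃ (c : ℝ → W) (ε : ℝ), 0 < ε ∧ EqOn c b (Ici 0) ∧
      IsMIntegralCurveOn (I := 𝓡 m) c Q (Ioi (-ε)) := by
  obtain ⟨F, V, ε, -, hbV, hε, hF, -⟩ := exists_localFlow hQ (b 0)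
  obtain ⟨hF0, hFc⟩ := hF _ hbV
  have hpos : ∀ t, 0 ≤ t → (if 0 ≤ t then b t else F (b 0) t) = b t := fun t ht => if_pos ht
  have hneg : ∀ t, t ≤ 0 → (if 0 ≤ t then b t else F (b 0) t) = F (b 0) t := fun t ht => by
    rcases ht.lt_or_eq with h | rfl
    · exact if_neg (not_le.2 h)
    · rw [if_pos le_rfl, hF0]
  refine ⟨fun t => if 0 ≤ t then b t else F (b 0) t, ε, hε, hpos, fun t ht => ?_⟩
  apply HasMFDerivAt.hasMFDerivWithinAt
  have hcast : ∀ (c : ℝ → W) (t : ℝ) (q : W), c t = q →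
      HasMFDerivAt 𝓘(ℝ, ℝ) (𝓡 m) c t ((1 : ℝ →L[ℝ] ℝ).smulRight (Q q)) →
      HasMFDerivAt 𝓘(ℝ, ℝ) (𝓡 m) c t ((1 : ℝ →L[ℝ] ℝ).smulRight (Q (c t))) := by
    rintro c t _ rfl h
    exact h
  rcases lt_trichotomy t 0 with h | rfl | h
  · have h1 := (hFc t ⟨ht, h.trans hε⟩).hasMFDerivAt (Ioo_mem_nhds ht (h.trans hε))
    refine hcast _ _ _ (hneg t h.le) ?_
    refine h1.congr_of_eventuallyEq ?_
    filter_upwards [Iio_mem_nhds h] with s hs using hneg s (le_of_lt hs)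
  · have h1 := (hFc 0 ⟨ht, hε⟩).hasMFDerivAt (Ioo_mem_nhds ht hε)
    have h2 := hb 0 self_mem_Ici
    refine hcast _ _ _ (hpos 0 le_rfl) ?_
    rw [hF0] at h1
    have h3 := (h1.hasMFDerivWithinAt.congr_mono (t := Iic 0) (fun s hs => hneg s hs) (hneg 0 le_rfl)
      (subset_univ _)).union (h2.congr_mono (t := Ici 0) (fun s hs => hpos s hs) (hpos 0 le_rfl) subset_rfl)
    rw [Iic_union_Ici] at h3
    exact hasMFDerivWithinAt_univ.1 h3
  · have h1 := (hb t h.le).hasMFDerivAt (Ici_mem_nhds h)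
    refine hcast _ _ _ (hpos t h.le) ?_
    refine h1.congr_of_eventuallyEq ?_
    filter_upwards [Ioi_mem_nhds h] with s hs using hpos s (le_of_lt hs)

variable [T2Space W]

lemma eq_of_forward {Q : (w : W) → TangentSpace (𝓡 m) w}
    (hQ : ContMDiff (𝓡 m) (𝓡 m).tangent ∞ (fun w => (⟨w, Q w⟩ : TangentBundle (𝓡 m) W)))
    {b : ℝ → W} (hb : IsMIntegralCurveOn (I := 𝓡 m) b Q (Ici 0)) {c : ℝ → W} {ε s : ℝ}
    (hε : 0 < ε) (hs : 0 ≤ s) (hc : IsMIntegralCurveOn (I := 𝓡 m) c Q (Ioo (-ε) ε))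
    (hbc : c 0 = b s) {t : ℝ} (ht : t ∈ Ioo (-ε) ε) (hst : 0 ≤ t + s) : b (t + s) = c t := by
  obtain ⟨d, δ, hδ, hdb, hd⟩ := exists_extension_of_forward hQ hb
  have h1 : IsMIntegralCurveOn (I := 𝓡 m) (d ∘ (· + s)) Q (Ioo (max (-ε) (-δ - s)) ε) :=
    (hd.comp_add s).mono fun t ht => by
      have := (max_lt_iff.1 ht.1).2
      change -δ < t + s
      linarith
  have h2 : IsMIntegralCurveOn (I := 𝓡 m) c Q (Ioo (max (-ε) (-δ - s)) ε) :=
    hc.mono (Ioo_subset_Ioo_left (le_max_left _ _))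
  have h0 : (0 : ℝ) ∈ Ioo (max (-ε) (-δ - s)) ε := ⟨max_lt (by linarith) (by linarith), hε⟩
  have ht' : t ∈ Ioo (max (-ε) (-δ - s)) ε := ⟨max_lt ht.1 (by linarith), ht.2⟩
  rw [← isMIntegralCurveOn_Ioo_eqOn_of_contMDiff_boundaryless h0 (hQ.of_le (by simp)) h1 h2
    (by simp [hbc, hdb (mem_Ici.2 hs)]) ht']
  exact (hdb hst).symm

/-- Continuous dependence on the initial value: convergence at time `s` propagates to all nearby
times, locally uniformly. -/
lemma exists_nhds_tendsto_forward {Q : (w : W) → TangentSpace (𝓡 m) w}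
    (hQ : ContMDiff (𝓡 m) (𝓡 m).tangent ∞ (fun w => (⟨w, Q w⟩ : TangentBundle (𝓡 m) W)))
    {ι : Type*} {l : Filter ι} {b : ι → ℝ → W} {a : ℝ → W}
    (hb : ∀ i, IsMIntegralCurveOn (I := 𝓡 m) (b i) Q (Ici 0))
    (ha : IsMIntegralCurveOn (I := 𝓡 m) a Q (Ici 0)) (T : ℝ) :
    ∃ U ∈ 𝓝 T, ∀ s ∈ U, ∀ t ∈ U,
      Tendsto (fun i => b i (max s 0)) l (𝓝 (a (max s 0))) →
      Tendsto (fun z : ι × ℝ => b z.1 (max z.2 0)) (l ×ˢ 𝓝 t) (𝓝 (a (max t 0))) := by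
  obtain ⟨F, V, ε, hV, haV, hε, hF, hFc⟩ := exists_localFlow hQ (a (max T 0))
  have hcont : Continuous fun s => a (max s 0) :=
    ha.continuousOn.comp_continuous (by fun_prop) fun s => le_max_right s 0
  refine ⟨(fun s => a (max s 0)) ⁻¹' V ∩ Metric.ball T (ε / 2), inter_mem
    (hcont.continuousAt.preimage_mem_nhds (hV.mem_nhds haV)) (Metric.ball_mem_nhds _ (half_pos hε)),
    fun s hs t ht hlim => ?_⟩
  have hsV : a (max s 0) ∈ V := hs.1
  have hst : dist t s < ε :=
    (dist_triangle_right t s T).trans_lt (by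
      have h1 : dist t T < ε / 2 := ht.2
      have h2 : dist s T < ε / 2 := hs.2
      linarith)
  have hmax : ∀ t' : ℝ, dist t' s < ε → max t' 0 - max s 0 ∈ Ioo (-ε) ε := fun t' h => by
    rw [mem_Ioo, ← abs_lt]
    exact (abs_max_sub_max_le_abs t' s 0).trans_lt h
  have key : ∀ {c : ℝ → W}, IsMIntegralCurveOn (I := 𝓡 m) c Q (Ici 0) → c (max s 0) ∈ V →
      ∀ t' : ℝ, dist t' s < ε → c (max t' 0) = F (c (max s 0)) (max t' 0 - max s 0) :=
    fun hc hcV t' ht' => by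
      have := eq_of_forward hQ hc hε (le_max_right s 0) (hF _ hcV).2 (hF _ hcV).1 (hmax t' ht')
        (by simp)
      rwa [sub_add_cancel] at this
  rw [key ha hsV t hst]
  have h1 : Tendsto (fun z : ι × ℝ => (b z.1 (max s 0), max z.2 0 - max s 0)) (l ×ˢ 𝓝 t)
      (𝓝 (a (max s 0), max t 0 - max s 0)) :=
    (hlim.comp tendsto_fst).prodMk_nhds
      (((by fun_prop : Continuous fun t' : ℝ => max t' 0 - max s 0).tendsto t).comp tendsto_snd)
  refine ((hFc _ hsV _ (hmax t hst)).tendsto.comp h1).congr' ?_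
  have h2 : ∀ᶠ z : ι × ℝ in l ×ˢ 𝓝 t, b z.1 (max s 0) ∈ V :=
    (hlim.comp tendsto_fst).eventually (hV.eventually_mem hsV)
  have h3 : ∀ᶠ z : ι × ℝ in l ×ˢ 𝓝 t, dist z.2 s < ε :=
    tendsto_snd.eventually ((by fun_prop : Continuous fun t' : ℝ => dist t' s).continuousAt.eventually
      (gt_mem_nhds hst))
  filter_upwards [h2, h3] with z hz2 hz3
  exact (key (hb z.1) hz2 z.2 hz3).symm

/-- Continuous dependence of forward solutions on the initial value. The truncation `max t 0`
expresses that only times `t ≥ 0` matter. -/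
theorem tendsto_forward {Q : (w : W) → TangentSpace (𝓡 m) w}
    (hQ : ContMDiff (𝓡 m) (𝓡 m).tangent ∞ (fun w => (⟨w, Q w⟩ : TangentBundle (𝓡 m) W)))
    {ι : Type*} {l : Filter ι} {b : ι → ℝ → W} {a : ℝ → W}
    (hb : ∀ i, IsMIntegralCurveOn (I := 𝓡 m) (b i) Q (Ici 0))
    (ha : IsMIntegralCurveOn (I := 𝓡 m) a Q (Ici 0))
    (h0 : Tendsto (fun i => b i 0) l (𝓝 (a 0))) (T : ℝ) :
    Tendsto (fun z : ι × ℝ => b z.1 (max z.2 0)) (l ×ˢ 𝓝 T) (𝓝 (a (max T 0))) := by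
  have hpt : ∀ t, Tendsto (fun z : ι × ℝ => b z.1 (max z.2 0)) (l ×ˢ 𝓝 t) (𝓝 (a (max t 0))) →
      Tendsto (fun i => b i (max t 0)) l (𝓝 (a (max t 0))) := fun t h =>
    h.comp (tendsto_id.prodMk (tendsto_const_pure.mono_right (pure_le_nhds t)))
  have hall : ∀ t, Tendsto (fun i => b i (max t 0)) l (𝓝 (a (max t 0))) := fun t => by
    refine PreconnectedSpace.induction₂' (fun s t =>
      Tendsto (fun i => b i (max s 0)) l (𝓝 (a (max s 0))) →
      Tendsto (fun i => b i (max t 0)) l (𝓝 (a (max t 0)))) (fun s => ?_)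
      ⟨fun _ _ _ h1 h2 h => h2 (h1 h)⟩ 0 t (by simpa using h0)
    obtain ⟨U, hU, h⟩ := exists_nhds_tendsto_forward hQ (l := l) hb ha s
    filter_upwards [hU] with t ht
    exact ⟨fun h1 => hpt t (h s (mem_of_mem_nhds hU) t ht h1),
      fun h1 => hpt s (h t ht s (mem_of_mem_nhds hU) h1)⟩
  obtain ⟨U, hU, h⟩ := exists_nhds_tendsto_forward hQ (l := l) hb ha T
  exact h T (mem_of_mem_nhds hU) T (mem_of_mem_nhds hU) (hall T)

lemma eqOn_of_forward {Q : (w : W) → TangentSpace (𝓡 m) w}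
    (hQ : ContMDiff (𝓡 m) (𝓡 m).tangent ∞ (fun w => (⟨w, Q w⟩ : TangentBundle (𝓡 m) W)))
    {a b : ℝ → W} (hb : IsMIntegralCurveOn (I := 𝓡 m) b Q (Ici 0))
    (ha : IsMIntegralCurveOn (I := 𝓡 m) a Q (Ici 0)) (h0 : b 0 = a 0) : EqOn b a (Ici 0) := by
  intro t ht
  have h := tendsto_forward hQ (l := pure ()) (b := fun _ : Unit => b) (fun _ => hb) ha
    (by rw [h0]; exact tendsto_const_nhds) t
  have h1 := h.comp (tendsto_id.prodMk (tendsto_const_pure.mono_right (pure_le_nhds t)))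
  have h2 : b (max t 0) = a (max t 0) := tendsto_nhds_unique
    (tendsto_const_nhds : Tendsto (fun _ : Unit => b (max t 0)) (pure ()) _) h1
  simpa [max_eq_left (mem_Ici.1 ht)] using h2

end ManifoldFlow

/-! ### Solutions with zero output -/

section Recurrence

variable {n : ℕ} (S : AffineSystem n)

lemma AffineSystem.IsForwardSolution.continuousOn {u : ℝ → ℝ} {x : ℝ → Vec n}
    (hx : S.IsForwardSolution u x) : ContinuousOn x (Ici 0) :=
  fun t ht => (hx t ht).continuousWithinAt

lemma tendsto_gronwallBound_zero (K T : ℝ) :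
    Tendsto (fun η => gronwallBound η K η T) (𝓝 0) (𝓝 0) := by
  rcases eq_or_ne K 0 with rfl | hK
  · simp only [gronwallBound_K0]
    exact Continuous.tendsto' (by fun_prop) _ _ (by simp)
  · simp only [gronwallBound_of_K_ne_0 hK]
    exact Continuous.tendsto' (by fun_prop) _ _ (by simp)

/-- Continuous dependence of bounded solutions on the input and the initial value. -/
lemma AffineSystem.tendsto_solution {u : ℝ → ℝ} {v : ℕ → ℝ → ℝ} {x : ℕ → ℝ → Vec n}
    {y : ℝ → Vec n} {R T : ℝ} (hT : 0 ≤ T) (hu : ContinuousOn u (Icc 0 T))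
    (hv : TendstoUniformlyOn v u atTop (Icc 0 T)) (hx : ∀ i, S.IsForwardSolution (v i) (x i))
    (hy : S.IsForwardSolution u y) (hxR : ∀ i, ∀ t, 0 ≤ t → x i t ∈ Metric.closedBall 0 R)
    (hyR : ∀ t, 0 ≤ t → y t ∈ Metric.closedBall 0 R)
    (h0 : Tendsto (fun i => x i 0) atTop (𝓝 (y 0))) :
    Tendsto (fun i => x i T) atTop (𝓝 (y T)) := by
  have hcomp : IsCompact (Metric.closedBall (0 : Vec n) R) := isCompact_closedBall _ _
  obtain ⟨Lf, hLf⟩ := ((S.smooth_f.of_le (by simp : (1 : WithTop ℕ∞) ≤ ∞)).locallyLipschitz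
    |>.locallyLipschitzOn (s := Metric.closedBall 0 R)).exists_lipschitzOnWith_of_compact hcomp
  obtain ⟨Lg, hLg⟩ := ((S.smooth_g.of_le (by simp : (1 : WithTop ℕ∞) ≤ ∞)).locallyLipschitz
    |>.locallyLipschitzOn (s := Metric.closedBall 0 R)).exists_lipschitzOnWith_of_compact hcomp
  obtain ⟨G, hG⟩ := hcomp.exists_bound_of_continuousOn S.smooth_g.continuous.continuousOn
  obtain ⟨M, hM⟩ := isCompact_Icc.exists_bound_of_continuousOn hu
  have hM0 : 0 ≤ M := (norm_nonneg _).trans (hM 0 ⟨le_rfl, hT⟩)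
  lift M to NNReal using hM0
  let K : NNReal := Lf + M * Lg
  have hlip : ∀ t ∈ Ico 0 T,
      LipschitzOnWith K (fun x => S.f x + u t • S.g x) (Metric.closedBall 0 R) := fun t ht => by
    refine LipschitzOnWith.of_dist_le_mul fun p hp q hq => ?_
    refine (dist_add_add_le _ _ _ _).trans ?_
    rw [dist_smul₀]
    have h1 := hLf.dist_le_mul p hp q hq
    have h2 := hLg.dist_le_mul p hp q hq
    have h3 := hM t (Ico_subset_Icc_self ht)
    calc dist (S.f p) (S.f q) + ‖u t‖ * dist (S.g p) (S.g q)
        ≤ Lf * dist p q + M * (Lg * dist p q) := by gcongr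
      _ = K * dist p q := by simp only [K]; push_cast; ring
  rw [Metric.tendsto_atTop]
  intro ε hε
  have hη : ∀ᶠ η in 𝓝[>] (0 : ℝ), gronwallBound η K η T < ε :=
    ((tendsto_gronwallBound_zero K T).mono_left nhdsWithin_le_nhds).eventually (gt_mem_nhds hε)
  obtain ⟨η, hηε, hη0⟩ := (hη.and self_mem_nhdsWithin).exists
  have hη0 : 0 < η := hη0
  have hG1 : 0 < |G| + 1 := by positivity
  obtain ⟨N₁, hN₁⟩ := Metric.tendsto_atTop.1 h0 η hη0
  obtain ⟨N₂, hN₂⟩ := eventually_atTop.1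
    (Metric.tendstoUniformlyOn_iff.1 hv (η / (|G| + 1)) (by positivity))
  refine ⟨max N₁ N₂, fun i hi => ?_⟩
  have hd : ∀ {u : ℝ → ℝ} {x : ℝ → Vec n}, S.IsForwardSolution u x → ∀ t ∈ Ico 0 T,
      HasDerivWithinAt x (S.f (x t) + u t • S.g (x t)) (Ici t) t := fun h t ht =>
    (h t ht.1).mono (Ici_subset_Ici.2 ht.1)
  have := dist_le_of_approx_trajectories_ODE_of_mem (s := fun _ => Metric.closedBall 0 R)
    (εf := η) (εg := 0) (δ := η) hlip ((hx i).continuousOn.mono Icc_subset_Ici_self) (hd (hx i))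
    (fun t ht => ?_) (fun t ht => hxR i t ht.1) (hy.continuousOn.mono Icc_subset_Ici_self)
    (hd hy) (fun t _ => by simp) (fun t ht => hyR t ht.1)
    (hN₁ i ((le_max_left _ _).trans hi)).le T ⟨hT, le_rfl⟩
  · rw [add_zero, sub_zero] at this
    exact this.trans_lt hηε
  · rw [dist_add_left, dist_eq_norm, ← sub_smul, norm_smul]
    have h1 : ‖v i t - u t‖ < η / (|G| + 1) := by
      have := hN₂ i ((le_max_right _ _).trans hi) t (Ico_subset_Icc_self ht)
      rwa [dist_comm, dist_eq_norm] at this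
    have h2 : ‖S.g (x i t)‖ ≤ |G| + 1 :=
      (hG _ (hxR i t ht.1)).trans ((le_abs_self G).trans (by linarith))
    calc ‖v i t - u t‖ * ‖S.g (x i t)‖ ≤ η / (|G| + 1) * (|G| + 1) := by gcongr
      _ = η := by field_simp

variable {m : ℕ} {W : Type*} [TopologicalSpace W] [T2Space W] [ChartedSpace (Vec m) W]
  [IsManifold (𝓡 m) ∞ W]

/-- Every input of a Poisson-stable exosystem to which the system adapts is the input of a
solution with output identically zero, namely of a limit of time shifts of an arbitrary solution
along times at which the exosystem recurs. -/
theorem exists_solution_output_eq_zero (Γ : Exosystem m W) (hΓ : Γ.IsPoissonStable)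
    (hadapt : S.Adapts Γ.generatedInputs) {u : ℝ → ℝ} (hu : u ∈ Γ.generatedInputs) :
    ∃ x : ℝ → Vec n, S.IsForwardSolution u x ∧ ∀ t, 0 ≤ t → S.h (x t) = 0 := by
  obtain ⟨w, hw, huw⟩ := hu
  obtain ⟨w', hw'0, hw', t, ht, htw⟩ := hΓ (w 0)
  have hww : EqOn w' w (Ici 0) := eqOn_of_forward Γ.smooth_Q hw' hw hw'0
  obtain ⟨x, -, hx, hxb, hxh⟩ := hadapt u ⟨w, hw, huw⟩ 0
  have ht0 : ∀ᶠ i in atTop, 0 ≤ t i := ht.eventually_ge_atTop 0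
  obtain ⟨x₁, -, σ, hσ, hσx⟩ := tendsto_subseq_of_bounded hxb
    (x := fun i => x (max (t i) 0)) (fun i => mem_image_of_mem x (mem_Ici.2 (le_max_right _ _)))
  let τ : ℕ → ℝ := fun i => max (t (σ i)) 0
  have hτ0 : ∀ i, 0 ≤ τ i := fun i => le_max_right _ _
  have hτ : Tendsto τ atTop atTop :=
    tendsto_atTop_mono (fun i => le_max_left _ _) (ht.comp hσ.tendsto_atTop)
  have hτw : Tendsto (fun i => w (τ i)) atTop (𝓝 (w 0)) := by
    refine (htw.comp hσ.tendsto_atTop).congr' ?_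
    filter_upwards [hσ.tendsto_atTop.eventually ht0] with i hi
    simp only [τ, Function.comp_apply, max_eq_left hi]
    exact hww hi
  obtain ⟨y, hy0, hy, hyb, -⟩ := hadapt u ⟨w, hw, huw⟩ x₁
  refine ⟨y, hy, fun T hT => ?_⟩
  obtain ⟨R, hR⟩ := (hxb.union hyb).subset_closedBall 0
  have hshift : ∀ i, IsMIntegralCurveOn (I := 𝓡 m) (fun s => w (s + τ i)) Γ.Q (Ici 0) := fun i =>
    (IsMIntegralCurveOn.comp_add hw (τ i)).mono fun s hs => add_nonneg hs (hτ0 i)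
  have hlim := tendsto_forward Γ.smooth_Q hshift hw (l := atTop) (by simpa using hτw)
  have hucont : ContinuousOn u (Icc 0 T) :=
    (Γ.smooth_θ.continuous.comp_continuousOn hw.continuousOn).mono Icc_subset_Ici_self |>.congr
      fun s hs => huw s hs.1
  have hunif : TendstoUniformlyOn (fun i s => u (s + τ i)) u atTop (Icc 0 T) := by
    rw [← tendstoLocallyUniformlyOn_iff_tendstoUniformlyOn_of_compact isCompact_Icc,
      tendstoLocallyUniformlyOn_iff_forall_tendsto]
    intro s hs
    have h1 : Tendsto (fun z : ℕ × ℝ => u (max z.2 0 + τ z.1)) (atTop ×ˢ 𝓝[Icc 0 T] s)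
        (𝓝 (u s)) := by
      have := ((Γ.smooth_θ.continuous.tendsto _).comp (hlim s)).mono_left
        (prod_mono le_rfl (nhdsWithin_le_nhds (s := Icc 0 T)))
      rw [max_eq_left hs.1, ← huw s hs.1] at this
      refine this.congr fun z => ?_
      exact (huw _ (add_nonneg (le_max_right _ _) (hτ0 _))).symm
    have h2 : Tendsto (fun z : ℕ × ℝ => u z.2) (atTop ×ˢ 𝓝[Icc 0 T] s) (𝓝 (u s)) :=
      (hucont s hs).tendsto.comp tendsto_snd
    have h3 : ∀ᶠ z : ℕ × ℝ in atTop ×ˢ 𝓝[Icc 0 T] s, z.2 ∈ Icc 0 T :=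
      tendsto_snd.eventually self_mem_nhdsWithin
    have h4 := (h2.prodMk_nhds h1).mono_right (nhds_le_uniformity (u s))
    refine h4.congr' ?_
    filter_upwards [h3] with z hz
    rw [max_eq_left hz.1]
  have hsol : ∀ i, S.IsForwardSolution (fun s => u (s + τ i)) (fun s => x (s + τ i)) := by
    intro i s hs
    have h1 : HasDerivWithinAt (fun s => s + τ i) 1 (Ici 0) s :=
      (hasDerivWithinAt_id s _).add_const _
    have h2 := (hx (s + τ i) (add_nonneg hs (hτ0 i))).scomp s h1
      (fun s hs => add_nonneg hs (hτ0 i))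
    simpa [Function.comp_def] using h2
  have hconv := S.tendsto_solution hT hucont hunif hsol hy
    (fun i s hs => hR (Or.inl (mem_image_of_mem x (add_nonneg hs (hτ0 i)))))
    (fun s hs => hR (Or.inr (mem_image_of_mem y hs))) (by simpa [hy0, τ, Function.comp_def] using hσx)
  have h1 := (S.smooth_h.continuous.tendsto _).comp hconv
  have h2 : Tendsto (fun i => S.h (x (T + τ i))) atTop (𝓝 0) :=
    hxh.comp (tendsto_atTop_add_const_left _ T hτ)
  exact tendsto_nhds_unique h1 h2

end Recurrence

/-! ### The frame of a system with uniform relative degree -/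

section RelativeDegree

variable {n : ℕ}

lemma contDiff_lieDeriv {X : Vec n → Vec n} {p : Vec n → ℝ} (hX : ContDiff ℝ ∞ X)
    (hp : ContDiff ℝ ∞ p) : ContDiff ℝ ∞ (lieDeriv X p) :=
  (hp.fderiv_right (m := ∞) (by simp)).clm_apply hX

lemma lieDeriv_lieBracket {V X : Vec n → Vec n} {p : Vec n → ℝ} (hV : ContDiff ℝ ∞ V)
    (hX : ContDiff ℝ ∞ X) (hp : ContDiff ℝ ∞ p) (x : Vec n) :
    lieDeriv (VectorField.lieBracket ℝ V X) p x =
      lieDeriv V (lieDeriv X p) x - lieDeriv X (lieDeriv V p) x :=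
  VectorField.fderiv_apply_lieBracket (n := ∞) hp.contDiffAt
    (by rw [minSmoothness_of_isRCLikeNormedField]; exact WithTop.coe_le_coe.2 le_top)
    (hX.differentiable (by simp) x) (hV.differentiable (by simp) x)

/-- Constant multiples of a complete vector field have global flows. -/
lemma IsCompleteField.exists_isFlow {X : Vec n → Vec n} (hX : IsCompleteField X) (c : ℝ) :
    ∃ φ : ℝ → Vec n → Vec n, IsFlow (fun x => c • X x) φ := by
  choose γ hγ0 hγ using hX
  refine ⟨fun t x => γ x (c * t), fun x => by simp [hγ0], fun t x => ?_⟩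
  have h := (hγ x (c * t)).scomp t ((hasDerivAt_id t).const_mul c)
  simpa [Function.comp_def] using h

namespace AffineSystem

variable (S : AffineSystem n) {r : ℕ}

lemma outputDeriv_succ (k : ℕ) : S.outputDeriv (k + 1) = lieDeriv S.f (S.outputDeriv k) :=
  Function.iterate_succ_apply' _ _ _

lemma contDiff_outputDeriv (k : ℕ) : ContDiff ℝ ∞ (S.outputDeriv k) := by
  induction k with
  | zero => exact S.smooth_h
  | succ k ih => rw [S.outputDeriv_succ]; exact contDiff_lieDeriv S.smooth_f ih

lemma contDiff_gTilde (hr : S.HasUniformRelativeDegree r) : ContDiff ℝ ∞ (S.gTilde r) :=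
  ((contDiff_lieDeriv S.smooth_g (S.contDiff_outputDeriv _)).inv hr.2.2).smul S.smooth_g

lemma contDiff_fTilde (hr : S.HasUniformRelativeDegree r) : ContDiff ℝ ∞ (S.fTilde r) :=
  S.smooth_f.sub ((S.contDiff_outputDeriv r).smul (S.contDiff_gTilde hr))

lemma tau_one : S.tau r 1 = S.gTilde r := rfl

lemma tau_add_two (j : ℕ) :
    S.tau r (j + 2) = VectorField.lieBracket ℝ (S.fTilde r) (S.tau r (j + 1)) :=
  Function.iterate_succ_apply' _ _ _

lemma contDiff_tau (hr : S.HasUniformRelativeDegree r) (j : ℕ) :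
    ContDiff ℝ ∞ (S.tau r (j + 1)) := by
  induction j with
  | zero => exact S.contDiff_gTilde hr
  | succ j ih => rw [S.tau_add_two]; exact (S.contDiff_fTilde hr).lieBracket_vectorField ih (by simp)

lemma lieDeriv_gTilde (hr : S.HasUniformRelativeDegree r) {k : ℕ} (hk : k < r) (x : Vec n) :
    lieDeriv (S.gTilde r) (S.outputDeriv k) x = if k + 1 = r then 1 else 0 := by
  have h : lieDeriv (S.gTilde r) (S.outputDeriv k) x =
      (lieDeriv S.g (S.outputDeriv (r - 1)) x)⁻¹ * lieDeriv S.g (S.outputDeriv k) x := by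
    simp [lieDeriv, gTilde]
  rw [h]
  split_ifs with hkr
  · rw [show k = r - 1 by omega, inv_mul_cancel₀ (hr.2.2 x)]
  · rw [hr.2.1 k (by omega) x, mul_zero]

lemma lieDeriv_fTilde (hr : S.HasUniformRelativeDegree r) {k : ℕ} (hk : k < r) (x : Vec n) :
    lieDeriv (S.fTilde r) (S.outputDeriv k) x = if k + 1 = r then 0 else S.outputDeriv (k + 1) x := by
  have h : lieDeriv (S.fTilde r) (S.outputDeriv k) x =
      S.outputDeriv (k + 1) x - S.outputDeriv r x * lieDeriv (S.gTilde r) (S.outputDeriv k) x := by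
    rw [S.outputDeriv_succ]
    simp [lieDeriv, fTilde]
  rw [h, S.lieDeriv_gTilde hr hk]
  split_ifs with hkr
  · rw [hkr, mul_one, sub_self]
  · rw [mul_zero, sub_zero]

/-- The fields `τ` differentiate the functions `L_f^k h` to constants. -/
lemma lieDeriv_tau (hr : S.HasUniformRelativeDegree r) (j : ℕ) : ∀ {k : ℕ}, k < r → ∀ x,
    lieDeriv (S.tau r (j + 1)) (S.outputDeriv k) x = if k + j + 1 = r then (-1) ^ j else 0 := by
  induction j with
  | zero => intro k hk x; simpa [tau_one] using S.lieDeriv_gTilde hr hk x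
  | succ j ih =>
    intro k hk x
    rw [S.tau_add_two, lieDeriv_lieBracket (S.contDiff_fTilde hr) (S.contDiff_tau hr j)
      (S.contDiff_outputDeriv k)]
    have h1 : lieDeriv (S.fTilde r) (lieDeriv (S.tau r (j + 1)) (S.outputDeriv k)) x = 0 := by
      rw [show lieDeriv (S.tau r (j + 1)) (S.outputDeriv k) = fun _ => _ from funext (ih hk)]
      simp [lieDeriv]
    rw [h1, zero_sub]
    by_cases hkr : k + 1 = r
    · rw [show lieDeriv (S.fTilde r) (S.outputDeriv k) = fun _ => 0 from
        funext fun y => by rw [S.lieDeriv_fTilde hr hk, if_pos hkr], if_neg (by omega)]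
      simp [lieDeriv]
    · rw [show lieDeriv (S.fTilde r) (S.outputDeriv k) = S.outputDeriv (k + 1) from
        funext fun y => by rw [S.lieDeriv_fTilde hr hk, if_neg hkr], ih (by omega)]
      have : k + 1 + j + 1 = r ↔ k + (j + 1) + 1 = r := by omega
      simp only [this]
      split_ifs <;> simp [pow_succ]

/-- The map `ξ = (h, L_f h, …, L_f^{r-1} h)`. -/
def outputMap (r : ℕ) (x : Vec n) : Vec r := WithLp.toLp 2 fun k : Fin r => S.outputDeriv k x

/-- The fields `(-1)^{r-1-k} τ_{r-k}`, `0 ≤ k < r`; the sign and the reversed order make them the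
coordinate fields of `ξ`. -/
def frameField (r : ℕ) (k : Fin r) : Vec n → Vec n :=
  (-1 : ℝ) ^ (r - 1 - (k : ℕ)) • S.tau r (r - 1 - k + 1)

lemma contDiff_outputMap : ContDiff ℝ ∞ (S.outputMap r) :=
  contDiff_euclidean.2 fun k => S.contDiff_outputDeriv k

lemma contDiff_frameField (hr : S.HasUniformRelativeDegree r) (k : Fin r) :
    ContDiff ℝ ∞ (S.frameField r k) := by
  change ContDiff ℝ ∞ fun x => (-1 : ℝ) ^ (r - 1 - (k : ℕ)) • S.tau r (r - 1 - k + 1) x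
  exact (S.contDiff_tau hr _).const_smul _

lemma fderiv_outputMap_apply (x v : Vec n) (k : Fin r) :
    fderiv ℝ (S.outputMap r) x v k = fderiv ℝ (S.outputDeriv k) x v := by
  have h := (EuclideanSpace.proj (𝕜 := ℝ) k : Vec r →L[ℝ] ℝ).hasFDerivAt.comp x
    ((S.contDiff_outputMap (r := r)).differentiable (by simp) x).hasFDerivAt
  have h2 : HasFDerivAt (S.outputDeriv k) ((EuclideanSpace.proj (𝕜 := ℝ) k : Vec r →L[ℝ] ℝ) ∘L
    fderiv ℝ (S.outputMap r) x) x := h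
  rw [h2.fderiv]
  rfl

lemma frameField_last (hr : S.HasUniformRelativeDegree r) :
    S.frameField r ⟨r - 1, Nat.sub_lt hr.1 one_pos⟩ = S.gTilde r := by
  simp [frameField, tau_one]

lemma f_eq_fTilde_add (x : Vec n) :
    S.f x = S.fTilde r x + S.outputDeriv r x • S.gTilde r x := by
  simp [fTilde]

lemma g_eq_smul_gTilde (hr : S.HasUniformRelativeDegree r) (x : Vec n) :
    S.g x = lieDeriv S.g (S.outputDeriv (r - 1)) x • S.gTilde r x := by
  rw [gTilde, smul_smul, mul_inv_cancel₀ (hr.2.2 x), one_smul]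

/-- For `k ≥ 1`, the bracket of the `k`-th frame field with `f̃` is the `(k-1)`-st frame field. -/
lemma lieBracket_frameField_fTilde (hr : S.HasUniformRelativeDegree r) {k : ℕ} (hk : k + 1 < r)
    (x : Vec n) :
    VectorField.lieBracket ℝ (S.frameField r ⟨k + 1, hk⟩) (S.fTilde r) x =
      S.frameField r ⟨k, by omega⟩ x := by
  obtain ⟨j, hj⟩ : ∃ j, r - 1 - (k + 1) = j := ⟨_, rfl⟩
  have hj' : r - 1 - k = j + 1 := by omega
  simp only [frameField, hj, hj']
  rw [VectorField.lieBracket_const_smul_left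
    ((S.contDiff_tau hr j).differentiable (by simp) x), VectorField.lieBracket_swap, Pi.smul_apply,
    S.tau_add_two, pow_succ]
  simp

/-- Under the hypotheses on the fields `τ_i`, the frame fields are transverse to the fibres
of `ξ`. -/
theorem exists_isTransverseFrame (hr : S.HasUniformRelativeDegree r)
    (hcomplete : ∀ i ∈ Finset.Icc 1 r, IsCompleteField (S.tau r i))
    (hcommute : ∀ i ∈ Finset.Icc 1 r, ∀ j ∈ Finset.Icc 1 r, ∀ x : Vec n,
      VectorField.lieBracket ℝ (S.tau r i) (S.tau r j) x = 0) :
    ∃ φ, IsTransverseFrame (S.outputMap r) (S.frameField r) φ := by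
  have hmem : ∀ k : Fin r, r - 1 - (k : ℕ) + 1 ∈ Finset.Icc 1 r := fun k => by
    rw [Finset.mem_Icc]; omega
  have hdiff : ∀ (k : Fin r) x, DifferentiableAt ℝ (S.tau r (r - 1 - k + 1)) x := fun k x =>
    (S.contDiff_tau hr _).differentiable (by simp) x
  choose φ hφ using fun k : Fin r => (hcomplete _ (hmem k)).exists_isFlow ((-1) ^ (r - 1 - (k : ℕ)))
  refine ⟨φ, S.contDiff_outputMap, S.contDiff_frameField hr, hφ,
    fun j k x => ?_, fun k x => ?_⟩
  · have hd : DifferentiableAt ℝ (S.frameField r k) x := (hdiff k x).const_smul _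
    rw [frameField, VectorField.lieBracket_const_smul_left (hdiff j x), frameField,
      VectorField.lieBracket_const_smul_right (hdiff k x), hcommute _ (hmem j) _ (hmem k)]
    simp
  · ext i
    have h := S.lieDeriv_tau hr (r - 1 - k) i.2 x
    rw [lieDeriv] at h
    rw [S.fderiv_outputMap_apply, frameField, Pi.smul_apply, map_smul, h, PiLp.single_apply]
    have : (i : ℕ) + (r - 1 - k) + 1 = r ↔ i = k := by rw [Fin.ext_iff]; omega
    simp only [this, smul_eq_mul]
    split_ifs <;> simp [← mul_pow]

/-- A function vanishing along a solution on `[0, ∞)` has vanishing derivative along it. -/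
lemma lieDeriv_add_eq_zero {u : ℝ → ℝ} {x : ℝ → Vec n} (hx : S.IsForwardSolution u x)
    {p : Vec n → ℝ} (hp : ContDiff ℝ ∞ p) (h0 : ∀ t, 0 ≤ t → p (x t) = 0) {t : ℝ} (ht : 0 ≤ t) :
    lieDeriv S.f p (x t) + u t * lieDeriv S.g p (x t) = 0 := by
  have h1 := (hp.differentiable (by simp) (x t)).hasFDerivAt.comp_hasDerivWithinAt t (hx t ht)
  have h2 : HasDerivWithinAt (p ∘ x) 0 (Ici 0) t :=
    (hasDerivWithinAt_const t (Ici 0) (0 : ℝ)).congr (fun s hs => h0 s hs) (h0 t ht)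
  have := (uniqueDiffOn_Ici (0 : ℝ) t ht).eq_deriv _ h1 h2
  simpa [lieDeriv] using this

/-- Along a solution with identically zero output, the functions `L_f^k h`, `k < r`, vanish. -/
lemma outputDeriv_eq_zero_of_output_eq_zero (hr : S.HasUniformRelativeDegree r) {u : ℝ → ℝ}
    {x : ℝ → Vec n} (hx : S.IsForwardSolution u x) (hh : ∀ t, 0 ≤ t → S.h (x t) = 0) {k : ℕ}
    (hk : k < r) : ∀ t, 0 ≤ t → S.outputDeriv k (x t) = 0 := by
  induction k with
  | zero => exact hh
  | succ k ih =>
    intro t ht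
    have h := S.lieDeriv_add_eq_zero hx (S.contDiff_outputDeriv k) (ih (by omega)) ht
    rwa [hr.2.1 k hk, mul_zero, add_zero, ← S.outputDeriv_succ] at h

/-- The input that keeps the output equal to zero is `-L_f^r h / L_g L_f^{r-1} h`. -/
lemma input_eq_of_output_eq_zero (hr : S.HasUniformRelativeDegree r) {u : ℝ → ℝ}
    {x : ℝ → Vec n} (hx : S.IsForwardSolution u x) (hh : ∀ t, 0 ≤ t → S.h (x t) = 0) {t : ℝ}
    (ht : 0 ≤ t) :
    -S.outputDeriv r (x t) / lieDeriv S.g (S.outputDeriv (r - 1)) (x t) = u t := by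
  have hr1 : r - 1 < r := Nat.sub_lt hr.1 one_pos
  have h := S.lieDeriv_add_eq_zero hx (S.contDiff_outputDeriv (r - 1))
    (S.outputDeriv_eq_zero_of_output_eq_zero hr hx hh hr1) ht
  rw [← S.outputDeriv_succ, Nat.sub_add_cancel hr.1] at h
  rw [div_eq_iff (hr.2.2 _)]
  linarith

end AffineSystem

end RelativeDegree

/-! ### The normal form and the internal model -/

section NormalForm

variable {n d : ℕ} {N : Type*} [TopologicalSpace N] [ChartedSpace (Vec d) N]

/-- The image of a smooth vector field under the differential of a smooth map is smooth, as a
map to the tangent bundle. -/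
lemma contMDiff_mfderiv_apply [IsManifold (𝓡 d) ∞ N] {G : Vec n → N} (hG : ContMDiff (𝓡 n) (𝓡 d) ∞ G)
    {V : Vec n → Vec n} (hV : ContDiff ℝ ∞ V) :
    ContMDiff (𝓡 n) (𝓡 d).tangent ∞
      (fun x => (⟨G x, mfderiv (𝓡 n) (𝓡 d) G x (V x)⟩ : TangentBundle (𝓡 d) N)) := by
  have h1 : ContMDiff (𝓡 n) (𝓡 n).tangent ∞ (fun x => (⟨x, V x⟩ : TangentBundle (𝓡 n) (Vec n))) :=
    fun x => contMDiffAt_vectorSpace_iff_contDiffAt.2 hV.contDiffAt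
  exact (hG.contMDiff_tangentMap (m := ∞) (by simp)).comp h1

lemma tangentBundle_mk_congr {a b : N} (hab : a = b) (v : Vec d) :
    (⟨a, v⟩ : TangentBundle (𝓡 d) N) = ⟨b, v⟩ := by
  subst hab
  rfl

/-- If `G` factors through a map `p`, the image of a tangent vector under `DG` depends only on
its image under `Dp`. -/
lemma mfderiv_eq_of_factor {G : Vec n → N} (hG : ContMDiff (𝓡 n) (𝓡 d) ∞ G)
    {p : Vec n → Vec n} (hp : ContDiff ℝ ∞ p) (hGp : ∀ x, G (p x) = G x) (x v : Vec n) :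
    (mfderiv (𝓡 n) (𝓡 d) G x v : Vec d) = mfderiv (𝓡 n) (𝓡 d) G (p x) (fderiv ℝ p x v) := by
  have h1 : MDifferentiableAt (𝓡 n) (𝓡 d) G (p x) := hG.mdifferentiable (by simp) (p x)
  have h2 : MDifferentiableAt (𝓡 n) (𝓡 n) p x := (hp.differentiable (by simp) x).mdifferentiableAt
  have h3 := mfderiv_comp x h1 h2
  rw [mfderiv_eq_fderiv] at h3
  have h4 : G ∘ p = G := funext hGp
  rw [h4] at h3
  rw [h3]
  rfl

end NormalForm

end InternalModel

end

open InternalModel in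
theorem theorem1 {n : ℕ} (S : InternalModel.AffineSystem n)
    -- the system has a uniform relative degree
    (r : ℕ) (hr : S.HasUniformRelativeDegree r)
    -- the vector fields `τ₁, …, τᵣ` are complete
    (hcomplete : ∀ i ∈ Finset.Icc 1 r, InternalModel.IsCompleteField (S.tau r i))
    -- they commute with each other
    (hcommute : ∀ i ∈ Finset.Icc 1 r, ∀ j ∈ Finset.Icc 1 r, ∀ x : InternalModel.Vec n,
      VectorField.lieBracket ℝ (S.tau r i) (S.tau r j) x = 0)
    -- a Poisson-stable exosystem
    {m : ℕ} {W : Type*} [TopologicalSpace W] [T2Space W]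
    [ChartedSpace (InternalModel.Vec m) W] [IsManifold (𝓡 m) ∞ W]
    (Γ : InternalModel.Exosystem m W) (hΓ : Γ.IsPoissonStable)
    -- the system adapts to the inputs generated by the exosystem
    (hadapt : S.Adapts Γ.generatedInputs) :
    S.ContainsOutputDrivenInternalModel Γ.generatedInputs := by
  obtain ⟨φ, h⟩ := S.exists_isTransverseFrame hr hcomplete hcommute
  have hξh : ∀ (x : Vec n) (k : Fin r), S.outputMap r x k = S.outputDeriv k x := fun _ _ => rfl
  -- the type `{x // ξ x = 0}` carries a manifold structure chosen below, so `ξ` is made opaque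
  generalize S.outputMap r = ξ at h hξh
  have hle : r ≤ n := by
    have hrank := LinearMap.finrank_range_add_finrank_ker
      (fderiv ℝ ξ 0 : Vec n →ₗ[ℝ] Vec r)
    rw [LinearMap.range_eq_top.2 (h.surjective_fderiv 0), finrank_top, finrank_euclideanSpace_fin,
      finrank_euclideanSpace_fin] at hrank
    omega
  obtain ⟨cs, hman, hι, hlift⟩ := exists_manifold_levelSet h.contDiff_map h.surjective_fderiv
  let i₀ : Fin r := ⟨0, hr.1⟩
  let P : Vec n → {x // ξ x = 0} := fun x => ⟨frameProj ξ φ x, h.map_frameProj x⟩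
  have hP : ContMDiff (𝓡 n) (𝓡 (n - r)) ∞ P := hlift P h.contDiff_frameProj
  have hPP : ∀ x, P (frameProj ξ φ x) = P x := fun x =>
    Subtype.ext (h.frameProj_of_map_eq_zero (h.map_frameProj x))
  have hξm : ContMDiff (𝓡 n) (𝓡 r) ∞ ξ := h.contDiff_map.contMDiff
  have hg0 : ∀ x, fderiv ℝ (frameProj ξ φ) x (S.gTilde r x) = 0 := fun x => by
    rw [← S.frameField_last hr, h.fderiv_frameProj_apply]
  have hbr : ∀ k ≠ i₀, ∃ j, ∀ x, VectorField.lieBracket ℝ (S.frameField r k) (S.fTilde r) x =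
      S.frameField r j x := by
    rintro ⟨k, hk⟩ hk0
    obtain ⟨k, rfl⟩ : ∃ l, k = l + 1 :=
      Nat.exists_eq_succ_of_ne_zero fun h0 => hk0 (Fin.ext h0)
    exact ⟨_, S.lieBracket_frameField_fTilde hr hk⟩
  have hact : ContMDiff ((𝓡 r).prod (𝓡 (n - r))) (𝓡 n) ∞
      (fun p : Vec r × {x // ξ x = 0} => frameAction φ p.1 p.2) :=
    h.contDiff_frameAction.contMDiff.comp (contMDiff_fst.prodMk_space (hι.comp contMDiff_snd))
  have hflow : ContMDiff (𝓘(ℝ, ℝ).prod (𝓡 (n - r))) (𝓡 n) ∞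
      (fun p : ℝ × {x // ξ x = 0} => φ i₀ p.1 p.2) :=
    ((h.isFlow i₀).contDiff (h.contDiff i₀)).contMDiff.comp
      (contMDiff_fst.prodMk_space (hι.comp contMDiff_snd))
  -- `f` and `f̃` have the same projection, and moving `x` along the frame fields other than the
  -- one of index `0` does not change it
  have hPf : ∀ x, (mfderiv (𝓡 n) (𝓡 (n - r)) P x (S.f x) : Vec (n - r)) =
      mfderiv (𝓡 n) (𝓡 (n - r)) P (φ i₀ (ξ x i₀) (P x)) (S.fTilde r (φ i₀ (ξ x i₀) (P x))) := by
    intro x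
    rw [mfderiv_eq_of_factor hP h.contDiff_frameProj hPP x,
      mfderiv_eq_of_factor hP h.contDiff_frameProj hPP (φ i₀ (ξ x i₀) (P x)), S.f_eq_fTilde_add,
      map_add, map_smul, hg0, smul_zero, add_zero,
      h.fderiv_frameProj_eq (S.contDiff_fTilde hr) hbr x, h.frameProj_flow,
      h.frameProj_of_map_eq_zero (P x).2]
  have hPg : ∀ x, (mfderiv (𝓡 n) (𝓡 (n - r)) P x (S.g x) : Vec (n - r)) = 0 := by
    intro x
    rw [mfderiv_eq_of_factor hP h.contDiff_frameProj hPP x, S.g_eq_smul_gTilde hr, map_smul, hg0,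
      smul_zero]
    exact map_zero _
  -- the inverse runs the flows from a point of `{ξ = 0}`, for times given by the coordinates `ξ`
  let Φ : Diffeomorph (𝓡 n) ((𝓡 r).prod (𝓡 (n - r))) (Vec n) (Vec r × {x // ξ x = 0}) ∞ :=
    { toFun := fun x => (ξ x, P x)
      invFun := fun p => frameAction φ p.1 p.2
      left_inv := fun x => h.frameAction_frameProj x
      right_inv := fun p => by
        refine Prod.ext ?_ (Subtype.ext ?_)
        · change ξ (frameAction φ p.1 p.2) = p.1
          rw [h.map_frameAction, p.2.2, zero_add]
        · change frameProj ξ φ (frameAction φ p.1 p.2) = p.2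
          rw [h.frameProj_frameAction, h.frameProj_of_map_eq_zero p.2.2]
      contMDiff_toFun := hξm.prodMk hP
      contMDiff_invFun := hact }
  refine ⟨r, hle, Vec r, inferInstance, inferInstance, inferInstance, {x // ξ x = 0}, inferInstance,
    cs, hman, inferInstance, inferInstance, inferInstance, inferInstance,
    fun s => s i₀,
    fun z₁ z₂ => mfderiv (𝓡 n) (𝓡 r) ξ (frameAction φ z₁ z₂) (S.f (frameAction φ z₁ z₂)),
    fun z₁ z₂ => mfderiv (𝓡 n) (𝓡 r) ξ (frameAction φ z₁ z₂) (S.g (frameAction φ z₁ z₂)),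
    fun y z₂ => mfderiv (𝓡 n) (𝓡 (n - r)) P (φ i₀ y z₂) (S.fTilde r (φ i₀ y z₂)),
    Φ, fun z => -S.outputDeriv r z / lieDeriv S.g (S.outputDeriv (r - 1)) z,
    ?_, ?_, ?_, ?_, ?_, ?_, ?_, fun x => hξh x i₀, ?_⟩
  · exact (by fun_prop : ContDiff ℝ ∞ fun s : Vec r => s i₀).contMDiff
  · refine ((contMDiff_mfderiv_apply hξm S.smooth_f).comp hact).congr fun p => ?_
    exact tangentBundle_mk_congr (Prod.ext_iff.1 (Φ.right_inv p)).1.symm _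
  · refine ((contMDiff_mfderiv_apply hξm S.smooth_g).comp hact).congr fun p => ?_
    exact tangentBundle_mk_congr (Prod.ext_iff.1 (Φ.right_inv p)).1.symm _
  · refine ((contMDiff_mfderiv_apply hP (S.contDiff_fTilde hr)).comp hflow).congr fun p => ?_
    refine tangentBundle_mk_congr (Subtype.ext ?_) _
    change (p.2 : Vec n) = frameProj ξ φ (φ i₀ p.1 p.2)
    rw [h.frameProj_flow, h.frameProj_of_map_eq_zero p.2.2]
  · exact (((S.contDiff_outputDeriv r).neg).div
      (contDiff_lieDeriv S.smooth_g (S.contDiff_outputDeriv (r - 1))) hr.2.2).contMDiff.comp hι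
  · intro x
    refine ⟨?_, hPf x⟩
    change _ = mfderiv (𝓡 n) (𝓡 r) ξ (frameAction φ (ξ x) (frameProj ξ φ x))
      (S.f (frameAction φ (ξ x) (frameProj ξ φ x)))
    rw [h.frameAction_frameProj]
    rfl
  · intro x
    refine ⟨?_, hPg x⟩
    change _ = mfderiv (𝓡 n) (𝓡 r) ξ (frameAction φ (ξ x) (frameProj ξ φ x))
      (S.g (frameAction φ (ξ x) (frameProj ξ φ x)))
    rw [h.frameAction_frameProj]
    rfl
  · intro u hu
    obtain ⟨x, hx, hx0⟩ := exists_solution_output_eq_zero S Γ hΓ hadapt hu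
    have hxξ : ∀ t, 0 ≤ t → ξ (x t) = 0 := fun t ht => by
      ext k
      rw [hξh, S.outputDeriv_eq_zero_of_output_eq_zero hr hx hx0 k.2 t ht]
      rfl
    -- the projection of a solution with zero output; it lies in `{ξ = 0}` already
    refine ⟨fun t => P (x t), fun t ht => ?_, fun t ht => ?_⟩
    · have h1 := ((hP.mdifferentiable (by simp) (x t)).hasMFDerivAt).comp_hasMFDerivWithinAt t
        (hx t ht).hasFDerivWithinAt.hasMFDerivWithinAt
      refine h1.congr_mfderiv ?_
      have h2 : (mfderiv (𝓡 n) (𝓡 (n - r)) P (x t) (S.f (x t) + u t • S.g (x t)) : Vec (n - r)) =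
          mfderiv (𝓡 n) (𝓡 (n - r)) P (φ i₀ 0 (P (x t))) (S.fTilde r (φ i₀ 0 (P (x t)))) := by
        have h3 := hPf (x t)
        rw [hxξ t ht] at h3
        refine ((mfderiv (𝓡 n) (𝓡 (n - r)) P (x t)).map_add _ _).trans ?_
        exact (congrArg₂ (· + ·) h3 (((mfderiv (𝓡 n) (𝓡 (n - r)) P (x t)).map_smul _ _).trans
          ((congrArg (u t • ·) (hPg (x t))).trans (smul_zero _)))).trans (add_zero _)
      refine ContinuousLinearMap.ext fun c => ?_
      exact ((mfderiv (𝓡 n) (𝓡 (n - r)) P (x t)).map_smul (c : ℝ) _).trans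
        (congrArg (fun v : Vec (n - r) => (show ℝ from c) • v) h2)
    · change -S.outputDeriv r (frameProj ξ φ (x t)) /
        lieDeriv S.g (S.outputDeriv (r - 1)) (frameProj ξ φ (x t)) = u t
      rw [h.frameProj_of_map_eq_zero (hxξ t ht), S.input_eq_of_output_eq_zero hr hx hx0 ht]
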